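/- Let $n\ge 1$, $m\in\mathbb N$, $A,Q\in\mathbb R^{n\times n}$ with $Q=Q^*$, $B\in\mathbb R^{n\times m}$, and assume the Kalman condition: the columns of $B,AB,\dots,A^{n-1}B$ span $\mathbb R^n$. Write $$e^{-\tau\Omega H}=\begin{pmatrix}R_1(\tau)&R_2(\tau)\\R_3(\tau)&R_4(\tau)\end{pmatrix},\qquad \Omega=\begin{pmatrix}0&\mathbb 1_n\\-\mathbb 1_n&0\end{pmatrix},\quad H=\begin{pmatrix}BB^*&A\\A^*&Q\end{pmatrix},$$ for the flow of the Hamiltonian system $\dot p=-A^*p-Qx$, $\dot x=BB^*p+Ax$, and $\exp_{x,\tau}(p)=R_3(\tau)p+R_4(\tau)x$. Let $t^*\in(0,+\infty]$ be the first conjugate time, i.e. the infimum of the $t>0$ for which there is a nontrivial solution of this system on $[0,t]$ with $x(0)=x(t)=0$, and let $0<T<t^*$. For $0<\tau\le T$ let $c^{0,\tau}(x,y)$ be the infimum of $\frac12\int_0^\tau(|u|^2-\gamma^*Q\gamma)\,dt$ over all absolutely continuous $\gamma:[0,\tau]\to\mathbb R^n$ and $u\in L^2([0,\tau],\mathbb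 R^m)$ with $\dot\gamma=A\gamma+Bu$ a.e., $\gamma(0)=x$, $\gamma(\tau)=y$; a minimizing $\gamma$ is called an optimal trajectory on $[0,\tau]$. Let $\mu,\nu$ be Borel probability measures on $\mathbb R^n$ with finite second moments, with $\mu$ absolutely continuous with respect to Lebesgue measure, and let $\psi:\mathbb R^n\to\mathbb R\cup\{+\infty\}$ be a Kantorovich potential from $\mu$ to $\nu$ for $c=c^{0,T}$: $\psi\not\equiv+\infty$ is $c$-convex, i.e. $\psi(x)=\sup_{(y,\lambda)\in\mathcal A}(\lambda-c(x,y))$ for some nonempty $\mathcal A\subset\mathbb R^n\times\mathbb R$, and some optimal plan from $\mu$ to $\nu$ for the cost $c$ is concentrated on $\{(x,y):\psi^c(y)=c(x,y)+\psi(x)\}$, where $\psi^c(y)=\inf_x(\psi(x)+c(x,y))$. Let $D$ be the set of the points near which $\psi$ is finite and at which $\psi$ is differentiable, and for $\tau\in[0,T]$ let $$T_\tau(z)=\exp_{z,\tau}(\nabla\psi(z)),\qquad z\in D.$$ (a) The maps $T_\tau$ are the optimal transport maps along the displacement interpolation from $\mu$ to $\nu$: $\mu(\mathbb R^n\setminus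 D)=0$; for $\mu$-a.e. $z$ the curve $\tau\mapsto T_\tau(z)$ is an optimal trajectory on $[0,T]$ starting at $z$; $T_T$ is an optimal transport map from $\mu$ to $\nu$ for $c^{0,T}$; and, for every $\tau\in(0,T]$, $T_\tau$ is an optimal transport map from $\mu$ to $\mu_\tau:=(T_\tau)_\sharp\mu$ for $c^{0,\tau}$. (b) Let $x\in\mathbb R^n$ be a point where $\psi$ is twice differentiable, i.e. $\psi$ is finite near $x$ and, for some $p\in\mathbb R^n$ and some symmetric matrix $S$, $$\psi(x+h)=\psi(x)+\langle p,h\rangle+\tfrac12\langle Sh,h\rangle+o(|h|^2)\qquad(h\to0).$$ Then $x\in D$, and for every $\tau\in[0,T]$ the map $T_\tau:D\to\mathbb R^n$ is differentiable at $x$, with a uniquely determined derivative $\nabla T_\tau(x)$. For every $s\in(0,T]$ and every $\tau\in[0,s]$, $$\det(\nabla T_\tau(x))^{1/n}\ \ge\ \frac{\det(R_3(\tau-s))^{1/n}}{\det(R_3(-s))^{1/n}}+\frac{\det(R_3(\tau))^{1/n}}{\det(R_3(s))^{1/n}}\,\det(\nabla T_s(x))^{1/n}.$$ Both terms on the right-hand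 side are non-negative, and the first one is positive if $\tau<s$. Moreover $\det(\nabla T_\tau(x))>0$ for every $\tau\in[0,T)$. (Here $a^{1/n}$ denotes the real $n$-th root of $a$, which is negative if $a<0$ and $n$ is odd.) -/

import Mathlib

open MeasureTheory Set Filter Topology Asymptotics

noncomputable section

namespace LQ

/-- Euclidean space `ℝⁿ`. -/
abbrev E (n : ℕ) := EuclideanSpace ℝ (Fin n)

variable {n m : ℕ}

/-- The action of a matrix on column vectors of Euclidean spaces. -/
abbrev act {k l : ℕ} (M : Matrix (Fin k) (Fin l) ℝ) (x : E l) : E k :=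
  Matrix.toEuclideanLin M x

/-! ### Linear quadratic control problems -/

/-- The Kalman condition: the columns of the matrices `A ^ j * B`, `0 ≤ j ≤ n - 1`, span `ℝⁿ`. -/
def Kalman (A : Matrix (Fin n) (Fin n) ℝ) (B : Matrix (Fin n) (Fin m) ℝ) : Prop :=
  Submodule.span ℝ {v : Fin n → ℝ | ∃ j < n, ∃ i : Fin m, v = (A ^ j * B).col i} = ⊤

/-- `γ` is an admissible trajectory on `[0, T]` with control `u`: `u ∈ L²([0, T], ℝᵐ)`, `γ` is
absolutely continuous on `[0, T]` and `γ' = A γ + B u` almost everywhere there. -/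
structure IsAdmissible (A : Matrix (Fin n) (Fin n) ℝ) (B : Matrix (Fin n) (Fin m) ℝ) (T : ℝ)
    (γ : ℝ → E n) (u : ℝ → E m) : Prop where
  memLp : MemLp u 2 (volume.restrict (Icc 0 T))
  absolutelyContinuous : AbsolutelyContinuousOnInterval γ 0 T
  ode : ∀ᵐ τ ∂(volume.restrict (Icc 0 T)), HasDerivAt γ (act A (γ τ) + act B (u τ)) τ

/-- The quadratic action `(1/2) ∫₀ᵀ (|u|² - γ* Q γ) dτ`. -/
def action (Q : Matrix (Fin n) (Fin n) ℝ) (T : ℝ) (γ : ℝ → E n) (u : ℝ → E m) : ℝ :=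
  (1 / 2) * ∫ τ in (0 : ℝ)..T, (‖u τ‖ ^ 2 - inner ℝ (γ τ) (act Q (γ τ)))

/-- The cost `c^{0,T}(x, y)`: the infimum of the action among the admissible trajectories on
`[0, T]` from `x` to `y`. Under the Kalman condition, and for `T` smaller than the first conjugate
time, the set of values is nonempty and bounded below, so that the real `sInf` is the infimum. -/
def cost (A : Matrix (Fin n) (Fin n) ℝ) (B : Matrix (Fin n) (Fin m) ℝ)
    (Q : Matrix (Fin n) (Fin n) ℝ) (T : ℝ) (x y : E n) : ℝ :=
  sInf {a : ℝ | ∃ (γ : ℝ → E n) (u : ℝ → E m),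
    IsAdmissible A B T γ u ∧ γ 0 = x ∧ γ T = y ∧ a = action Q T γ u}

/-- `γ` is an optimal trajectory on `[0, T]`: it is admissible and it realizes the cost between its
endpoints, i.e. its action is at most that of any admissible trajectory with the same endpoints. -/
def IsOptimalTrajectory (A : Matrix (Fin n) (Fin n) ℝ) (B : Matrix (Fin n) (Fin m) ℝ)
    (Q : Matrix (Fin n) (Fin n) ℝ) (T : ℝ) (γ : ℝ → E n) : Prop :=
  ∃ u : ℝ → E m, IsAdmissible A B T γ u ∧
    (∀ (η : ℝ → E n) (v : ℝ → E m), IsAdmissible A B T η v → η 0 = γ 0 → η T = γ T →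
      action Q T γ u ≤ action Q T η v) ∧
    action Q T γ u = cost A B Q T (γ 0) (γ T)

/-! ### The Hamiltonian flow -/

/-- `t > 0` is a conjugate time: some nontrivial solution on `[0, t]` of the Hamiltonian system
`p' = -A* p - Q x`, `x' = B B* p + A x` satisfies `x(0) = x(t) = 0`. -/
def IsConjugateTime (A : Matrix (Fin n) (Fin n) ℝ) (B : Matrix (Fin n) (Fin m) ℝ)
    (Q : Matrix (Fin n) (Fin n) ℝ) (t : ℝ) : Prop :=
  0 < t ∧ ∃ p x : ℝ → E n,
    (∀ τ ∈ Icc 0 t,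
      HasDerivWithinAt p (-act A.transpose (p τ) - act Q (x τ)) (Icc 0 t) τ) ∧
    (∀ τ ∈ Icc 0 t,
      HasDerivWithinAt x (act (B * B.transpose) (p τ) + act A (x τ)) (Icc 0 t) τ) ∧
    (∃ τ ∈ Icc 0 t, p τ ≠ 0 ∨ x τ ≠ 0) ∧ x 0 = 0 ∧ x t = 0

/-- The first conjugate time `t^*`, equal to `+∞` if there are no conjugate times. -/
def firstConjugateTime (A : Matrix (Fin n) (Fin n) ℝ) (B : Matrix (Fin n) (Fin m) ℝ)
    (Q : Matrix (Fin n) (Fin n) ℝ) : EReal :=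
  sInf {r : EReal | ∃ t : ℝ, IsConjugateTime A B Q t ∧ r = (t : EReal)}

/-- The matrix `H` of the quadratic Hamiltonian, in the coordinates `(p, x)`. -/
def hamiltonianMatrix (A : Matrix (Fin n) (Fin n) ℝ) (B : Matrix (Fin n) (Fin m) ℝ)
    (Q : Matrix (Fin n) (Fin n) ℝ) : Matrix (Fin n ⊕ Fin n) (Fin n ⊕ Fin n) ℝ :=
  Matrix.fromBlocks (B * B.transpose) A A.transpose Q

/-- The standard symplectic matrix `Ω`. -/
def symplecticMatrix (n : ℕ) : Matrix (Fin n ⊕ Fin n) (Fin n ⊕ Fin n) ℝ :=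
  Matrix.fromBlocks 0 1 (-1) 0

/-- The Hamiltonian flow `e^{-τ Ω H}`. -/
def flow (A : Matrix (Fin n) (Fin n) ℝ) (B : Matrix (Fin n) (Fin m) ℝ)
    (Q : Matrix (Fin n) (Fin n) ℝ) (τ : ℝ) : Matrix (Fin n ⊕ Fin n) (Fin n ⊕ Fin n) ℝ :=
  NormedSpace.exp (-(τ • (symplecticMatrix n * hamiltonianMatrix A B Q)))

/-- The lower left block `R₃(τ)` of the Hamiltonian flow. -/
def R₃ (A : Matrix (Fin n) (Fin n) ℝ) (B : Matrix (Fin n) (Fin m) ℝ)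
    (Q : Matrix (Fin n) (Fin n) ℝ) (τ : ℝ) : Matrix (Fin n) (Fin n) ℝ :=
  (flow A B Q τ).toBlocks₂₁

/-- The lower right block `R₄(τ)` of the Hamiltonian flow. -/
def R₄ (A : Matrix (Fin n) (Fin n) ℝ) (B : Matrix (Fin n) (Fin m) ℝ)
    (Q : Matrix (Fin n) (Fin n) ℝ) (τ : ℝ) : Matrix (Fin n) (Fin n) ℝ :=
  (flow A B Q τ).toBlocks₂₂

/-- The exponential map `exp_{x,τ}(p)`: the position at time `τ` of the integral curve of the
Hamiltonian system with initial datum `(p, x)`. -/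
def expMap (A : Matrix (Fin n) (Fin n) ℝ) (B : Matrix (Fin n) (Fin m) ℝ)
    (Q : Matrix (Fin n) (Fin n) ℝ) (τ : ℝ) (x p : E n) : E n :=
  act (R₃ A B Q τ) p + act (R₄ A B Q τ) x

/-! ### Optimal transport and Kantorovich potentials -/

/-- `α` is an optimal plan from `μ` to `ν` for the cost `c`. (For the quadratic costs and the
measures with finite second moments considered here, all these integrals converge.) -/
def IsOptimalPlan (c : E n → E n → ℝ) (μ ν : Measure (E n)) (α : Measure (E n × E n)) : Prop :=
  α.fst = μ ∧ α.snd = ν ∧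
    ∀ β : Measure (E n × E n), β.fst = μ → β.snd = ν →
      ∫ q, c q.1 q.2 ∂α ≤ ∫ q, c q.1 q.2 ∂β

/-- `F` is an optimal transport map from `μ` to `ν`: it pushes `μ` forward to `ν`, and the plan
`(id, F)_♯ μ` that it induces is optimal (so that `F` is also a minimizer of the Monge problem). -/
def IsOptimalMap (c : E n → E n → ℝ) (μ ν : Measure (E n)) (F : E n → E n) : Prop :=
  AEMeasurable F μ ∧ μ.map F = ν ∧ IsOptimalPlan c μ ν (μ.map fun z => (z, F z))

/-- `ψ : ℝⁿ → ℝ ∪ {+∞}`, not identically `+∞`, is `c`-convex. -/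
def IsCConvex (c : E n → E n → ℝ) (ψ : E n → EReal) : Prop :=
  (∃ x, ψ x ≠ ⊤) ∧ ∃ S : Set (E n × ℝ), S.Nonempty ∧
    ∀ x, ψ x = ⨆ q ∈ S, ((q.2 - c x q.1 : ℝ) : EReal)

/-- The `c`-transform `ψ^c(y) = inf_x (ψ(x) + c(x, y))`. -/
def cTransform (c : E n → E n → ℝ) (ψ : E n → EReal) (y : E n) : EReal :=
  ⨅ x, (ψ x + (c x y : EReal))

/-- The contact set `∂_c ψ`, i.e. the set of `(x, y)` with `ψ^c(y) = c(x, y) + ψ(x)`. -/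
def contactSet (c : E n → E n → ℝ) (ψ : E n → EReal) : Set (E n × E n) :=
  {q | cTransform c ψ q.2 = (c q.1 q.2 : EReal) + ψ q.1}

/-- `ψ` is a Kantorovich potential from `μ` to `ν`: it is `c`-convex and some optimal plan is
concentrated on its contact set. -/
def IsKantorovichPotential (c : E n → E n → ℝ) (μ ν : Measure (E n)) (ψ : E n → EReal) : Prop :=
  IsCConvex c ψ ∧ ∃ α, IsOptimalPlan c μ ν α ∧ ∀ᵐ q ∂α, q ∈ contactSet c ψ

/-! ### Differentiability of extended-real-valued functions -/

/-- `ψ` takes finite values in a neighbourhood of `x`. -/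
def FiniteNear (ψ : E n → EReal) (x : E n) : Prop :=
  ∀ᶠ z in 𝓝 x, ψ z ≠ ⊤ ∧ ψ z ≠ ⊥

/-- `ψ` is twice differentiable at `x`, in the sense of Alexandrov: it is finite near `x` and has a
second order expansion at `x`, with a vector `p` (the gradient) and a symmetric matrix `S` (the
Hessian). -/
def TwiceDifferentiableAt (ψ : E n → EReal) (x : E n) : Prop :=
  FiniteNear ψ x ∧ ∃ (p : E n) (S : Matrix (Fin n) (Fin n) ℝ), S.IsSymm ∧
    (fun h : E n => (ψ (x + h)).toReal - (ψ x).toReal - inner ℝ p h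
      - (1 / 2) * inner ℝ (act S h) h) =o[𝓝 0] fun h : E n => ‖h‖ ^ 2

/-- The set of the points at which `ψ` is differentiable (in particular, finite nearby). -/
def diffSet (ψ : E n → EReal) : Set (E n) :=
  {z | FiniteNear ψ z ∧ DifferentiableAt ℝ (fun w => (ψ w).toReal) z}

/-- The transport maps `T_τ(z) = exp_{z,τ}(∇ψ(z))` of the potential `ψ`. Only the values on
`diffSet ψ` are meaningful. -/
def transportMap (A : Matrix (Fin n) (Fin n) ℝ) (B : Matrix (Fin n) (Fin m) ℝ)
    (Q : Matrix (Fin n) (Fin n) ℝ) (ψ : E n → EReal) (τ : ℝ) (z : E n) : E n :=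
  expMap A B Q τ z (gradient (fun w => (ψ w).toReal) z)

/-- The derivative `∇T_τ(x)` of `T_τ`, as a map defined on the set of the points at which `ψ` is
differentiable. It is meaningful where `T_τ` is differentiable within that set and that set
determines derivatives at `x`. -/
def transportJacobian (A : Matrix (Fin n) (Fin n) ℝ) (B : Matrix (Fin n) (Fin m) ℝ)
    (Q : Matrix (Fin n) (Fin n) ℝ) (ψ : E n → EReal) (τ : ℝ) (x : E n) : E n →L[ℝ] E n :=
  fderivWithin ℝ (transportMap A B Q ψ τ) (diffSet ψ) x

/-- The real `n`-th root of `a`, for `n ≥ 1`: the usual one if `a ≥ 0`, and the negative one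
`-|a|^{1/n}` if `a < 0` (so it is the inverse of `r ↦ r ^ n` on `ℝ` if `n` is odd). -/
def nthRoot (n : ℕ) (a : ℝ) : ℝ := (SignType.sign a : ℝ) * |a| ^ (1 / (n : ℝ))

end LQ

end

open LQ

/-!
The cost `c^{0,τ}` is a quadratic form. The extremals of the control problem are the projections of
the integral curves of the Hamiltonian flow, and they are minimizers as long as there are no
conjugate points: along the solution `S = R₁ R₃⁻¹` of the Riccati equation, the difference of the
Lagrangians exceeds an exact derivative by a square (`riccati_deriv_le`). The solution is shifted
slightly to the past, which is possible because `T` is strictly smaller than the first conjugate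
time, and is then regular on the closed interval (`action_expMap_le`). This gives
`c^{0,τ}(x, y) = ⟨S(τ) y, y⟩ / 2 - ⟨R₃(τ)⁻¹ y, x⟩ + ⟨K(τ) x, x⟩ / 2` with `K = R₃⁻¹ R₄`
(`cost_eq`).

Hence a potential `ψ` is `c`-convex only if `ψ + ⟨K(T) x, x⟩ / 2` is convex. Such a function is
differentiable almost everywhere on its domain, which has full measure, and the first order
condition on the contact set reads `y = T_T(x)`. The derivative of `K` is `-(R₃⁻¹ B)(R₃⁻¹ B)*`, so
that `K` decreases in time and `ψ + ⟨K(τ) x, x⟩ / 2` is convex for all `τ ≤ T`; moreover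
`R₃(τ)⁻¹ T_τ = ∇ψ + K(τ)` is its gradient. Thus the graph of `T_τ` lies in the contact set of `ψ`
for the cost `c^{0,τ}` (`contact_transportMap`), which suffices for optimality
(`isOptimalPlan_of_contact`).

At a point where `ψ` has a second order expansion with Hessian `G`, the subgradients of the convex
function above have a first order expansion (`norm_subgradient_sub_le`), so the derivative of `T_τ`
is `R₃(τ) G + R₄(τ) = R₃(τ) ((K(τ) - K(s)) + (G + K(s)))` for `τ ≤ s`, with a sum of two positive
semidefinite matrices on the right. The inequality is Minkowski's determinant inequality
(`nthRoot_det_add_le`), since `R₃(τ) (K(τ) - K(s)) = R₃(τ - s) R₃(-s)⁻¹`, and the signs follow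
because `K(τ) - K(s)` is invertible for `τ < s` and the determinants of `R₃ G + R₄` equal `1` at
time `0`.
-/

namespace LQ

variable {n m : ℕ}

/-! ### Linear algebra -/

section LinearAlgebra

variable {k l : ℕ}

theorem act_mul (M : Matrix (Fin k) (Fin l) ℝ) (N : Matrix (Fin l) (Fin n) ℝ) (x : E n) :
    act (M * N) x = act M (act N x) := by
  ext i; simp [act, Matrix.mulVec_mulVec]

theorem act_one (x : E n) : act 1 x = x := by
  ext i; simp [act]

theorem act_zero (M : Matrix (Fin k) (Fin l) ℝ) : act M 0 = 0 := map_zero _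

theorem zero_act (x : E n) : act (0 : Matrix (Fin k) (Fin n) ℝ) x = 0 := by
  ext i; simp [act]

theorem add_act (M N : Matrix (Fin k) (Fin l) ℝ) (x : E l) :
    act (M + N) x = act M x + act N x := by simp [act]

theorem sub_act (M N : Matrix (Fin k) (Fin l) ℝ) (x : E l) :
    act (M - N) x = act M x - act N x := by simp [act]

theorem neg_act (M : Matrix (Fin k) (Fin l) ℝ) (x : E l) :
    act (-M) x = -act M x := by simp [act]

theorem act_add (M : Matrix (Fin k) (Fin l) ℝ) (x y : E l) :
    act M (x + y) = act M x + act M y := map_add _ _ _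

theorem act_sub (M : Matrix (Fin k) (Fin l) ℝ) (x y : E l) :
    act M (x - y) = act M x - act M y := map_sub _ _ _

theorem act_smul (M : Matrix (Fin k) (Fin l) ℝ) (c : ℝ) (x : E l) :
    act M (c • x) = c • act M x := map_smul _ _ _

theorem inner_act_left (M : Matrix (Fin k) (Fin l) ℝ) (x : E l) (y : E k) :
    inner ℝ (act M x) y = inner ℝ x (act M.transpose y) := by
  have := Matrix.toEuclideanLin_conjTranspose_eq_adjoint M
  rw [Matrix.conjTranspose_eq_transpose_of_trivial] at this
  rw [act, act, this, LinearMap.adjoint_inner_right]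

theorem inner_act_right (M : Matrix (Fin k) (Fin l) ℝ) (x : E l) (y : E k) :
    inner ℝ y (act M x) = inner ℝ (act M.transpose y) x := by
  rw [real_inner_comm, inner_act_left, real_inner_comm]

theorem inner_act_self_comm {S : Matrix (Fin n) (Fin n) ℝ} (hS : S.IsSymm) (x y : E n) :
    inner ℝ (act S x) y = inner ℝ (act S y) x := by
  rw [inner_act_left, hS.eq, real_inner_comm]

/-- The action of a matrix on Euclidean space, as a continuous linear map depending linearly on the
matrix. -/
noncomputable def actCLM : Matrix (Fin k) (Fin l) ℝ →ₗ[ℝ] (E l →L[ℝ] E k) :=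
  (LinearMap.toContinuousLinearMap : (E l →ₗ[ℝ] E k) ≃ₗ[ℝ] (E l →L[ℝ] E k)).toLinearMap ∘ₗ
    (Matrix.toEuclideanLin : Matrix (Fin k) (Fin l) ℝ ≃ₗ[ℝ] (E l →ₗ[ℝ] E k)).toLinearMap

@[simp] theorem actCLM_apply (M : Matrix (Fin k) (Fin l) ℝ) (x : E l) : actCLM M x = act M x := rfl

@[fun_prop]
theorem continuous_act (M : Matrix (Fin k) (Fin l) ℝ) : Continuous (act M) :=
  (actCLM M).continuous

theorem continuous_actCLM : Continuous (actCLM : Matrix (Fin k) (Fin l) ℝ →ₗ[ℝ] _) :=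
  LinearMap.continuous_of_finiteDimensional _

theorem det_actCLM (M : Matrix (Fin n) (Fin n) ℝ) : (actCLM M).det = M.det := by
  rw [ContinuousLinearMap.det]
  change LinearMap.det (Matrix.toEuclideanLin M) = _
  rw [Matrix.toEuclideanLin, Matrix.toLpLin_eq_toLin, LinearMap.det_toLin]

theorem posSemidef_of_inner {S : Matrix (Fin n) (Fin n) ℝ} (hS : S.IsSymm)
    (h : ∀ x : E n, 0 ≤ inner ℝ (act S x) x) : S.PosSemidef := by
  refine Matrix.PosSemidef.of_dotProduct_mulVec_nonneg ?_ fun x => ?_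
  · rw [Matrix.IsHermitian, Matrix.conjTranspose_eq_transpose_of_trivial, hS.eq]
  · have := h (WithLp.toLp 2 x)
    simpa [act, EuclideanSpace.inner_eq_star_dotProduct] using this

theorem _root_.Matrix.PosSemidef.inner_nonneg {S : Matrix (Fin n) (Fin n) ℝ} (hS : S.PosSemidef)
    (x : E n) : 0 ≤ inner ℝ (act S x) x := by
  have := hS.dotProduct_mulVec_nonneg x.ofLp
  simpa [act, EuclideanSpace.inner_eq_star_dotProduct] using this

end LinearAlgebra

/-! ### Real `n`-th roots and Minkowski's determinant inequality -/

theorem nthRoot_mul (n : ℕ) (a b : ℝ) : nthRoot n (a * b) = nthRoot n a * nthRoot n b := by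
  simp only [nthRoot, sign_mul, abs_mul, Real.mul_rpow (abs_nonneg a) (abs_nonneg b),
    SignType.coe_mul]
  ring

theorem nthRoot_of_nonneg (hn : 1 ≤ n) {a : ℝ} (ha : 0 ≤ a) :
    nthRoot n a = a ^ (1 / (n : ℝ)) := by
  rcases ha.eq_or_lt with rfl | h
  · have : (n : ℝ)⁻¹ ≠ 0 := by positivity
    simp [nthRoot, Real.zero_rpow this]
  · simp [nthRoot, sign_pos h, abs_of_pos h]

theorem nthRoot_nonneg {a : ℝ} (ha : 0 ≤ a) : 0 ≤ nthRoot n a := by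
  have : (0 : ℝ) ≤ (SignType.sign a : ℝ) := by
    rcases ha.eq_or_lt with rfl | h
    · simp
    · simp [sign_pos h]
  exact mul_nonneg this (by positivity)

theorem nthRoot_pos {a : ℝ} (ha : 0 < a) : 0 < nthRoot n a := by
  simp only [nthRoot, sign_pos ha, abs_of_pos ha]
  have := Real.rpow_pos_of_pos ha (1 / (n : ℝ))
  simpa using this

theorem nthRoot_one (n : ℕ) : nthRoot n 1 = 1 := by simp [nthRoot]

theorem nthRoot_zero (n : ℕ) : nthRoot n 0 = 0 := by simp [nthRoot]

theorem nthRoot_ne_zero (n : ℕ) {a : ℝ} (ha : a ≠ 0) : nthRoot n a ≠ 0 := by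
  intro h
  have := nthRoot_mul n a a⁻¹
  rw [mul_inv_cancel₀ ha, nthRoot_one, h, zero_mul] at this
  exact one_ne_zero this

theorem nthRoot_div (n : ℕ) (a : ℝ) {b : ℝ} (hb : b ≠ 0) :
    nthRoot n (a / b) = nthRoot n a / nthRoot n b := by
  have h : nthRoot n b * nthRoot n b⁻¹ = 1 := by
    rw [← nthRoot_mul, mul_inv_cancel₀ hb, nthRoot_one]
  rw [div_eq_mul_inv, nthRoot_mul, div_eq_mul_inv, eq_inv_of_mul_eq_one_right h]

/-- The product case of Minkowski's inequality: divide by the right-hand side and apply the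
inequality of arithmetic and geometric means to `1 / (1 + a i)` and to `a i / (1 + a i)`. -/
theorem one_add_prod_rpow_le (hn : 1 ≤ n) (a : Fin n → ℝ) (ha : ∀ i, 0 ≤ a i) :
    1 + (∏ i, a i) ^ (1 / (n : ℝ)) ≤ (∏ i, (1 + a i)) ^ (1 / (n : ℝ)) := by
  have hn' : (n : ℝ) ≠ 0 := by positivity
  have hp : ∀ i, 0 < 1 + a i := fun i => by linarith [ha i]
  have key : ∀ z : Fin n → ℝ, (∀ i, 0 ≤ z i) →
      (∏ i, z i) ^ (1 / (n : ℝ)) ≤ ∑ i, (1 / (n : ℝ)) * z i := fun z hz => by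
    have := Real.geom_mean_le_arith_mean_weighted Finset.univ (fun _ => 1 / (n : ℝ)) z
      (fun i _ => by positivity) (by simp [hn']) (fun i _ => hz i)
    rwa [Real.finsetProd_rpow _ _ (fun i _ => hz i)] at this
  have h1 := key (fun i => 1 / (1 + a i)) (fun i => by have := hp i; positivity)
  have h2 := key (fun i => a i / (1 + a i)) (fun i => div_nonneg (ha i) (hp i).le)
  have hs : ∑ i, (1 / (n : ℝ)) * (1 / (1 + a i)) + ∑ i, (1 / (n : ℝ)) * (a i / (1 + a i)) = 1 := by
    rw [← Finset.sum_add_distrib]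
    have : ∀ i, (1 / (n : ℝ)) * (1 / (1 + a i)) + (1 / (n : ℝ)) * (a i / (1 + a i))
        = 1 / (n : ℝ) := fun i => by
      have := (hp i).ne'
      field_simp
    rw [Finset.sum_congr rfl fun i _ => this i]
    simp [hn']
  have hP : 0 < ∏ i, (1 + a i) := Finset.prod_pos fun i _ => hp i
  have hP' := Real.rpow_pos_of_pos hP (1 / (n : ℝ))
  have h0 : 0 ≤ ∏ i, a i := Finset.prod_nonneg fun i _ => ha i
  rw [Finset.prod_div_distrib, Real.div_rpow (by simp) hP.le] at h1
  rw [Finset.prod_div_distrib, Real.div_rpow h0 hP.le] at h2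
  have := add_le_add h1 h2
  rw [hs, ← add_div, div_le_one hP'] at this
  simpa using this

theorem det_one_add_of_isHermitian {N : Matrix (Fin n) (Fin n) ℝ} (hN : N.IsHermitian) :
    (1 + N).det = ∏ i, (1 + hN.eigenvalues i) := by
  have h := congrArg (Polynomial.eval (-1)) hN.charpoly_eq
  rw [Matrix.eval_charpoly, Polynomial.eval_prod] at h
  have e : (Matrix.scalar (Fin n)) (-1 : ℝ) - N = -(1 + N) := by
    rw [map_neg, map_one]; abel
  rw [e, Matrix.det_neg] at h
  have h2 : ∀ i, Polynomial.eval (-1 : ℝ)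
      (Polynomial.X - Polynomial.C ((hN.eigenvalues i : ℝ))) = -1 * (1 + hN.eigenvalues i) :=
    fun i => by simp; ring
  simp only [RCLike.ofReal_real_eq_id, id, h2] at h
  rw [Finset.prod_mul_distrib] at h
  simp only [Finset.prod_const, Finset.card_univ, Fintype.card_fin] at h
  exact mul_left_cancel₀ (pow_ne_zero _ (by norm_num)) h

/-- **Minkowski's determinant inequality**. A congruence that turns the positive definite matrix
into the identity reduces it to a statement about the eigenvalues of the other matrix. -/
theorem nthRoot_det_add_le (hn : 1 ≤ n) {P N : Matrix (Fin n) (Fin n) ℝ} (hP : P.PosDef)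
    (hN : N.PosSemidef) :
    nthRoot n P.det + nthRoot n N.det ≤ nthRoot n (P + N).det := by
  open scoped MatrixOrder in
  obtain ⟨C, hC⟩ := CStarAlgebra.nonneg_iff_eq_star_mul_self.mp hP.posSemidef.nonneg
  rw [Matrix.star_eq_conjTranspose, Matrix.conjTranspose_eq_transpose_of_trivial] at hC
  have hdet : P.det = C.det * C.det := by rw [hC, Matrix.det_mul, Matrix.det_transpose]
  have hC0 : IsUnit C.det := by
    refine isUnit_iff_ne_zero.2 fun h => ?_
    have := hP.det_pos
    simp [hdet, h] at this
  have hN' : ((C⁻¹).transpose * N * C⁻¹).PosSemidef := by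
    have := hN.conjTranspose_mul_mul_same C⁻¹
    rwa [Matrix.conjTranspose_eq_transpose_of_trivial] at this
  have e1 : N = C.transpose * ((C⁻¹).transpose * N * C⁻¹) * C := by
    have h1 : C.transpose * (C⁻¹).transpose = 1 := by
      rw [← Matrix.transpose_mul, Matrix.nonsing_inv_mul _ hC0, Matrix.transpose_one]
    calc N = (C.transpose * (C⁻¹).transpose) * N * (C⁻¹ * C) := by
          rw [h1, Matrix.nonsing_inv_mul _ hC0, Matrix.one_mul, Matrix.mul_one]
      _ = _ := by simp only [Matrix.mul_assoc]
  have e2 : P + N = C.transpose * (1 + (C⁻¹).transpose * N * C⁻¹) * C := by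
    rw [Matrix.mul_add, Matrix.add_mul, ← e1, Matrix.mul_one, ← hC]
  have d1 : N.det = P.det * ((C⁻¹).transpose * N * C⁻¹).det := by
    rw [hdet]
    conv_lhs => rw [e1]
    rw [Matrix.det_mul, Matrix.det_mul, Matrix.det_transpose]; ring
  have d2 : (P + N).det = P.det * (1 + (C⁻¹).transpose * N * C⁻¹).det := by
    rw [e2, hdet, Matrix.det_mul, Matrix.det_mul, Matrix.det_transpose]; ring
  rw [d1, d2, nthRoot_mul, nthRoot_mul, det_one_add_of_isHermitian hN'.1,
    hN'.1.det_eq_prod_eigenvalues]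
  have hev := hN'.eigenvalues_nonneg
  have h := one_add_prod_rpow_le hn _ hev
  rw [← nthRoot_of_nonneg hn (Finset.prod_nonneg fun i _ => hev i),
    ← nthRoot_of_nonneg hn (Finset.prod_nonneg fun i _ => by linarith [hev i])] at h
  have hPn := nthRoot_nonneg (n := n) hP.det_pos.le
  calc nthRoot n P.det + nthRoot n P.det * nthRoot n (∏ i, hN'.1.eigenvalues i)
      = nthRoot n P.det * (1 + nthRoot n (∏ i, hN'.1.eigenvalues i)) := by ring
    _ ≤ _ := mul_le_mul_of_nonneg_left h hPn

/-! ### The Hamiltonian flow -/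

section Flow

open scoped Matrix Matrix.Norms.Operator

theorem hasDerivAt_act {M : ℝ → Matrix (Fin n) (Fin n) ℝ} {M' : Matrix (Fin n) (Fin n) ℝ}
    {ξ : ℝ → E n} {ξ' : E n} {τ : ℝ} (h : HasDerivAt M M' τ) (hξ : HasDerivAt ξ ξ' τ) :
    HasDerivAt (fun t => act (M t) (ξ t)) (act M' (ξ τ) + act (M τ) ξ') τ :=
  HasDerivAt.clm_apply
    (ContinuousLinearMap.hasFDerivAt (⟨actCLM, continuous_actCLM⟩ :
      Matrix (Fin n) (Fin n) ℝ →L[ℝ] (E n →L[ℝ] E n)) |>.comp_hasDerivAt τ h) hξ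

theorem hasDerivAt_act_const {M : ℝ → Matrix (Fin n) (Fin n) ℝ} {M' : Matrix (Fin n) (Fin n) ℝ}
    {τ : ℝ} (h : HasDerivAt M M' τ) (v : E n) :
    HasDerivAt (fun t => act (M t) v) (act M' v) τ :=
  (hasDerivAt_act h (hasDerivAt_const τ v)).congr_deriv (by rw [act_zero, add_zero])

variable (A : Matrix (Fin n) (Fin n) ℝ) (B : Matrix (Fin n) (Fin m) ℝ)
  (Q : Matrix (Fin n) (Fin n) ℝ)

/-- The upper left block `R₁(τ)` of the Hamiltonian flow. -/
noncomputable def R₁ (τ : ℝ) : Matrix (Fin n) (Fin n) ℝ := (flow A B Q τ).toBlocks₁₁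

/-- The upper right block `R₂(τ)` of the Hamiltonian flow. -/
noncomputable def R₂ (τ : ℝ) : Matrix (Fin n) (Fin n) ℝ := (flow A B Q τ).toBlocks₁₂

theorem flow_eq_fromBlocks (τ : ℝ) :
    flow A B Q τ = Matrix.fromBlocks (R₁ A B Q τ) (R₂ A B Q τ) (R₃ A B Q τ) (R₄ A B Q τ) :=
  (Matrix.fromBlocks_toBlocks _).symm

theorem flow_zero : flow A B Q 0 = 1 := by
  simp [flow]

theorem flow_add (s t : ℝ) : flow A B Q (s + t) = flow A B Q s * flow A B Q t := by
  rw [flow, flow, flow, ← Matrix.exp_add_of_commute]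
  · rw [add_smul, neg_add]
  · exact (((Commute.refl _).smul_left s).smul_right t).neg_left.neg_right

theorem neg_symplectic_mul_hamiltonian :
    -(symplecticMatrix n * hamiltonianMatrix A B Q) = Matrix.fromBlocks (-Aᵀ) (-Q) (B * Bᵀ) A := by
  simp [symplecticMatrix, hamiltonianMatrix, Matrix.fromBlocks_multiply, Matrix.fromBlocks_neg]

theorem hasDerivAt_flow (τ : ℝ) :
    HasDerivAt (flow A B Q)
      (-(symplecticMatrix n * hamiltonianMatrix A B Q) * flow A B Q τ) τ := by
  have := hasDerivAt_exp_smul_const' (𝕂 := ℝ)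
    (-(symplecticMatrix n * hamiltonianMatrix A B Q)) τ
  simpa only [smul_neg] using! this

theorem hasDerivAt_flow_apply (τ : ℝ) (i j : Fin n ⊕ Fin n) :
    HasDerivAt (fun t => flow A B Q t i j)
      ((Matrix.fromBlocks (-Aᵀ * R₁ A B Q τ - Q * R₃ A B Q τ) (-Aᵀ * R₂ A B Q τ - Q * R₄ A B Q τ)
        (B * Bᵀ * R₁ A B Q τ + A * R₃ A B Q τ) (B * Bᵀ * R₂ A B Q τ + A * R₄ A B Q τ)) i j) τ := by
  have h := hasDerivAt_flow A B Q τ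
  have e := Matrix.fromBlocks_multiply (-Aᵀ) (-Q) (B * Bᵀ) A (R₁ A B Q τ) (R₂ A B Q τ)
    (R₃ A B Q τ) (R₄ A B Q τ)
  rw [neg_symplectic_mul_hamiltonian, flow_eq_fromBlocks, e] at h
  simp only [Matrix.neg_mul Q, ← sub_eq_add_neg] at h
  exact hasDerivAt_pi.1 (hasDerivAt_pi.1 h i) j

theorem hasDerivAt_R₁ (τ : ℝ) :
    HasDerivAt (R₁ A B Q) (-Aᵀ * R₁ A B Q τ - Q * R₃ A B Q τ) τ :=
  hasDerivAt_pi.2 fun i => hasDerivAt_pi.2 fun j =>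
    hasDerivAt_flow_apply A B Q τ (Sum.inl i) (Sum.inl j)

theorem hasDerivAt_R₂ (τ : ℝ) :
    HasDerivAt (R₂ A B Q) (-Aᵀ * R₂ A B Q τ - Q * R₄ A B Q τ) τ :=
  hasDerivAt_pi.2 fun i => hasDerivAt_pi.2 fun j =>
    hasDerivAt_flow_apply A B Q τ (Sum.inl i) (Sum.inr j)

theorem hasDerivAt_R₃ (τ : ℝ) :
    HasDerivAt (R₃ A B Q) (B * Bᵀ * R₁ A B Q τ + A * R₃ A B Q τ) τ :=
  hasDerivAt_pi.2 fun i => hasDerivAt_pi.2 fun j =>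
    hasDerivAt_flow_apply A B Q τ (Sum.inr i) (Sum.inl j)

theorem hasDerivAt_R₄ (τ : ℝ) :
    HasDerivAt (R₄ A B Q) (B * Bᵀ * R₂ A B Q τ + A * R₄ A B Q τ) τ :=
  hasDerivAt_pi.2 fun i => hasDerivAt_pi.2 fun j =>
    hasDerivAt_flow_apply A B Q τ (Sum.inr i) (Sum.inr j)

theorem continuous_R₃ : Continuous (R₃ A B Q) :=
  continuous_iff_continuousAt.2 fun τ => (hasDerivAt_R₃ A B Q τ).continuousAt

theorem continuous_R₄ : Continuous (R₄ A B Q) :=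
  continuous_iff_continuousAt.2 fun τ => (hasDerivAt_R₄ A B Q τ).continuousAt

theorem R₁_zero : R₁ A B Q 0 = 1 := by
  rw [R₁, flow_zero, ← Matrix.fromBlocks_one, Matrix.toBlocks_fromBlocks₁₁]

theorem R₂_zero : R₂ A B Q 0 = 0 := by
  rw [R₂, flow_zero, ← Matrix.fromBlocks_one, Matrix.toBlocks_fromBlocks₁₂]

theorem R₃_zero : R₃ A B Q 0 = 0 := by
  rw [R₃, flow_zero, ← Matrix.fromBlocks_one, Matrix.toBlocks_fromBlocks₂₁]

theorem R₄_zero : R₄ A B Q 0 = 1 := by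
  rw [R₄, flow_zero, ← Matrix.fromBlocks_one, Matrix.toBlocks_fromBlocks₂₂]

theorem R₃_add (s t : ℝ) :
    R₃ A B Q (s + t) = R₃ A B Q s * R₁ A B Q t + R₄ A B Q s * R₃ A B Q t := by
  have h := congrArg Matrix.toBlocks₂₁ (flow_add A B Q s t)
  rw [flow_eq_fromBlocks A B Q s, flow_eq_fromBlocks A B Q t, Matrix.fromBlocks_multiply,
    Matrix.toBlocks_fromBlocks₂₁] at h
  exact h

theorem R₄_add (s t : ℝ) :
    R₄ A B Q (s + t) = R₃ A B Q s * R₂ A B Q t + R₄ A B Q s * R₄ A B Q t := by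
  have h := congrArg Matrix.toBlocks₂₂ (flow_add A B Q s t)
  rw [flow_eq_fromBlocks A B Q s, flow_eq_fromBlocks A B Q t, Matrix.fromBlocks_multiply,
    Matrix.toBlocks_fromBlocks₂₂] at h
  exact h

variable {Q}

/-- The flow is symplectic: transposition exchanges it, up to conjugation by `Ω`, with its
inverse. -/
theorem flow_transpose_mul_symplectic (hQ : Q.IsSymm) (τ : ℝ) :
    (flow A B Q τ)ᵀ * symplecticMatrix n = symplecticMatrix n * flow A B Q (-τ) := by
  have hΩ : symplecticMatrix n * symplecticMatrix n = -1 := by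
    simp [symplecticMatrix, Matrix.fromBlocks_multiply, ← Matrix.fromBlocks_one,
      Matrix.fromBlocks_neg]
  have hinv : (symplecticMatrix n)⁻¹ = -symplecticMatrix n :=
    Matrix.inv_eq_right_inv (by rw [Matrix.mul_neg, hΩ, neg_neg])
  have hu : IsUnit (symplecticMatrix n) :=
    IsUnit.of_mul_eq_one (-symplecticMatrix n) (by rw [Matrix.mul_neg, hΩ, neg_neg])
  have hH : (hamiltonianMatrix A B Q)ᵀ = hamiltonianMatrix A B Q := by
    simp [hamiltonianMatrix, Matrix.fromBlocks_transpose, hQ.eq]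
  have hΩt : (symplecticMatrix n)ᵀ = -symplecticMatrix n := by
    simp [symplecticMatrix, Matrix.fromBlocks_transpose, Matrix.fromBlocks_neg]
  have h := Matrix.exp_conj (symplecticMatrix n)
    (-(-τ • (symplecticMatrix n * hamiltonianMatrix A B Q))) hu
  have e : symplecticMatrix n * -(-τ • (symplecticMatrix n * hamiltonianMatrix A B Q)) *
      (symplecticMatrix n)⁻¹ = (-(τ • (symplecticMatrix n * hamiltonianMatrix A B Q)))ᵀ := by
    rw [hinv, Matrix.transpose_neg, Matrix.transpose_smul, Matrix.transpose_mul, hH, hΩt]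
    simp only [neg_smul, neg_neg, Matrix.mul_smul, Matrix.smul_mul, ← Matrix.mul_assoc, hΩ,
      Matrix.mul_neg, Matrix.neg_mul, Matrix.one_mul, smul_neg]
  rw [e, Matrix.exp_transpose] at h
  rw [flow, flow, h, Matrix.mul_assoc, Matrix.nonsing_inv_mul _
    ((Matrix.isUnit_iff_isUnit_det _).1 hu), Matrix.mul_one]

theorem R_neg (hQ : Q.IsSymm) (τ : ℝ) :
    R₁ A B Q (-τ) = (R₄ A B Q τ)ᵀ ∧ R₂ A B Q (-τ) = -(R₂ A B Q τ)ᵀ ∧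
      R₃ A B Q (-τ) = -(R₃ A B Q τ)ᵀ ∧ R₄ A B Q (-τ) = (R₁ A B Q τ)ᵀ := by
  have h := flow_transpose_mul_symplectic A B hQ τ
  rw [flow_eq_fromBlocks A B Q τ, flow_eq_fromBlocks A B Q (-τ), symplecticMatrix,
    Matrix.fromBlocks_transpose, Matrix.fromBlocks_multiply, Matrix.fromBlocks_multiply,
    Matrix.fromBlocks_inj] at h
  simp only [Matrix.mul_zero, Matrix.mul_one, Matrix.mul_neg, zero_add, add_zero, Matrix.zero_mul,
    Matrix.one_mul, Matrix.neg_mul] at h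
  obtain ⟨h1, h2, h3, h4⟩ := h
  exact ⟨(neg_injective h3).symm, by rw [h4, neg_neg], h1.symm, h2.symm⟩

theorem R₃_neg (hQ : Q.IsSymm) (τ : ℝ) : R₃ A B Q (-τ) = -(R₃ A B Q τ)ᵀ :=
  (R_neg A B hQ τ).2.2.1

/-- The identities between the blocks of a symplectic matrix. -/
theorem R_symplectic (hQ : Q.IsSymm) (τ : ℝ) :
    (R₁ A B Q τ)ᵀ * R₃ A B Q τ = (R₃ A B Q τ)ᵀ * R₁ A B Q τ ∧
    R₃ A B Q τ * (R₄ A B Q τ)ᵀ = R₄ A B Q τ * (R₃ A B Q τ)ᵀ ∧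
    (R₁ A B Q τ)ᵀ * R₄ A B Q τ - (R₃ A B Q τ)ᵀ * R₂ A B Q τ = 1 := by
  obtain ⟨h1, h2, h3, h4⟩ := R_neg A B hQ τ
  have e1 : flow A B Q (-τ) * flow A B Q τ = 1 := by rw [← flow_add, neg_add_cancel, flow_zero]
  have e2 : flow A B Q τ * flow A B Q (-τ) = 1 := by rw [← flow_add, add_neg_cancel, flow_zero]
  rw [flow_eq_fromBlocks A B Q τ, flow_eq_fromBlocks A B Q (-τ), h1, h2, h3, h4,
    Matrix.fromBlocks_multiply, ← Matrix.fromBlocks_one, Matrix.fromBlocks_inj] at e1 e2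
  obtain ⟨-, -, a3, a4⟩ := e1
  obtain ⟨-, -, b3, b4⟩ := e2
  rw [Matrix.neg_mul] at a3 a4
  rw [Matrix.mul_neg] at b4
  refine ⟨?_, ?_, ?_⟩
  · rw [← sub_eq_zero, ← a3]; abel
  · rw [← sub_eq_zero, ← b3, Matrix.mul_neg]; abel
  · rw [← a4]; abel

variable (Q)

/-! ### Conjugate times -/

theorem hasDerivAt_expMap_momentum (x p : E n) (τ : ℝ) :
    HasDerivAt (fun t => act (R₁ A B Q t) p + act (R₂ A B Q t) x)
      (-act Aᵀ (act (R₁ A B Q τ) p + act (R₂ A B Q τ) x) - act Q (expMap A B Q τ x p)) τ := by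
  refine ((hasDerivAt_act_const (hasDerivAt_R₁ A B Q τ) p).add
    (hasDerivAt_act_const (hasDerivAt_R₂ A B Q τ) x)).congr_deriv ?_
  simp only [expMap, sub_act, neg_act, act_mul, act_add]
  abel

theorem hasDerivAt_expMap (x p : E n) (τ : ℝ) :
    HasDerivAt (fun t => expMap A B Q t x p)
      (act (B * Bᵀ) (act (R₁ A B Q τ) p + act (R₂ A B Q τ) x)
        + act A (expMap A B Q τ x p)) τ := by
  refine ((hasDerivAt_act_const (hasDerivAt_R₃ A B Q τ) p).add
    (hasDerivAt_act_const (hasDerivAt_R₄ A B Q τ) x)).congr_deriv ?_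
  simp only [expMap, add_act, act_mul, act_add]
  abel

/-- Before the first conjugate time `R₃` is invertible: an element `p` of its kernel is the initial
covector of a solution that starts at `0` and returns there. -/
theorem isUnit_det_R₃ {t : ℝ} (ht : 0 < t) (ht' : (t : EReal) < firstConjugateTime A B Q) :
    IsUnit (R₃ A B Q t).det := by
  rw [isUnit_iff_ne_zero]
  intro h
  obtain ⟨v, hv, hv0⟩ := Matrix.exists_mulVec_eq_zero_iff.2 h
  have hp : (WithLp.toLp 2 v : E n) ≠ 0 := fun h => hv (by simpa using congrArg WithLp.ofLp h)
  set p : E n := WithLp.toLp 2 v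
  have hpt : act (R₃ A B Q t) p = 0 := by
    ext i; simpa [act, p] using congrFun hv0 i
  refine ht'.not_ge (sInf_le ⟨t, ⟨ht, fun τ => act (R₁ A B Q τ) p + act (R₂ A B Q τ) 0,
    fun τ => expMap A B Q τ 0 p, fun τ _ => ?_, fun τ _ => ?_, ⟨0, ⟨le_rfl, ht.le⟩, Or.inl ?_⟩,
    ?_, ?_⟩, rfl⟩)
  · exact (hasDerivAt_expMap_momentum A B Q 0 p τ).hasDerivWithinAt
  · exact (hasDerivAt_expMap A B Q 0 p τ).hasDerivWithinAt
  · simpa [R₁_zero, act_one, act_zero] using hp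
  · simp [expMap, R₃_zero, zero_act, act_zero]
  · simp [expMap, hpt, act_zero]

end Flow

/-! ### Riccati matrices and monotonicity -/

section Riccati

open scoped Matrix Matrix.Norms.Operator

variable (A : Matrix (Fin n) (Fin n) ℝ) (B : Matrix (Fin n) (Fin m) ℝ)
  (Q : Matrix (Fin n) (Fin n) ℝ)

/-- The matrix `R₃⁻¹ R₄`: the Hessian of the cost `c^{0,τ}` in its first variable. Its negative
takes `x` to the initial covector of the extremal that joins `x` to `0` in time `τ`. -/
noncomputable def initialHess (τ : ℝ) : Matrix (Fin n) (Fin n) ℝ := (R₃ A B Q τ)⁻¹ * R₄ A B Q τ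

/-- The matrix `R₁ R₃⁻¹`: the Hessian of the cost `c^{0,τ}` in its second variable. It takes `y` to
the final covector of the extremal that joins `0` to `y` in time `τ`. -/
noncomputable def finalHess (τ : ℝ) : Matrix (Fin n) (Fin n) ℝ := R₁ A B Q τ * (R₃ A B Q τ)⁻¹

theorem hasDerivAt_matrix_inv {M : ℝ → Matrix (Fin n) (Fin n) ℝ} {M' : Matrix (Fin n) (Fin n) ℝ}
    {t : ℝ} (h : HasDerivAt M M' t) (hu : IsUnit (M t).det) :
    HasDerivAt (fun s => (M s)⁻¹) (-((M t)⁻¹ * M' * (M t)⁻¹)) t := by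
  obtain ⟨u, hu⟩ := (Matrix.isUnit_iff_isUnit_det _).2 hu
  have h1 := hasFDerivAt_ringInverse (𝕜 := ℝ) u
  rw [hu] at h1
  have h2 := h1.comp_hasDerivAt t h
  have e : (↑u⁻¹ : Matrix (Fin n) (Fin n) ℝ) = (M t)⁻¹ := by rw [← hu, Matrix.coe_units_inv]
  simp only [e] at h2
  simpa [Matrix.nonsing_inv_eq_ringInverse, Function.comp_def] using! h2

variable {Q}

section SingleTime

variable {A B} {s : ℝ}

theorem isSymm_initialHess (hQ : Q.IsSymm) (hs : IsUnit (R₃ A B Q s).det) :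
    (initialHess A B Q s).IsSymm := by
  have h := (R_symplectic A B hQ s).2.1
  have e : (R₃ A B Q s)ᵀ * ((R₃ A B Q s)⁻¹)ᵀ = 1 := by
    rw [← Matrix.transpose_mul, Matrix.nonsing_inv_mul _ hs, Matrix.transpose_one]
  rw [Matrix.IsSymm, initialHess, Matrix.transpose_mul]
  calc (R₄ A B Q s)ᵀ * ((R₃ A B Q s)⁻¹)ᵀ
      = (R₃ A B Q s)⁻¹ * (R₃ A B Q s * (R₄ A B Q s)ᵀ) * ((R₃ A B Q s)⁻¹)ᵀ := by
        rw [← Matrix.mul_assoc (R₃ A B Q s)⁻¹, Matrix.nonsing_inv_mul _ hs, Matrix.one_mul]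
    _ = (R₃ A B Q s)⁻¹ * R₄ A B Q s * ((R₃ A B Q s)ᵀ * ((R₃ A B Q s)⁻¹)ᵀ) := by
        rw [h]; simp only [Matrix.mul_assoc]
    _ = _ := by rw [e, Matrix.mul_one]

theorem isSymm_finalHess (hQ : Q.IsSymm) (hs : IsUnit (R₃ A B Q s).det) :
    (finalHess A B Q s).IsSymm := by
  have h := (R_symplectic A B hQ s).1
  have e : ((R₃ A B Q s)⁻¹)ᵀ * (R₃ A B Q s)ᵀ = 1 := by
    rw [← Matrix.transpose_mul, Matrix.mul_nonsing_inv _ hs, Matrix.transpose_one]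
  rw [Matrix.IsSymm, finalHess, Matrix.transpose_mul]
  calc ((R₃ A B Q s)⁻¹)ᵀ * (R₁ A B Q s)ᵀ
      = ((R₃ A B Q s)⁻¹)ᵀ * ((R₁ A B Q s)ᵀ * R₃ A B Q s) * (R₃ A B Q s)⁻¹ := by
        rw [Matrix.mul_assoc, Matrix.mul_assoc (R₁ A B Q s)ᵀ, Matrix.mul_nonsing_inv _ hs,
          Matrix.mul_one]
    _ = ((R₃ A B Q s)⁻¹)ᵀ * (R₃ A B Q s)ᵀ * (R₁ A B Q s * (R₃ A B Q s)⁻¹) := by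
        rw [h]; simp only [Matrix.mul_assoc]
    _ = _ := by rw [e, Matrix.one_mul]

theorem R₂_sub_R₁_mul_initialHess (hQ : Q.IsSymm) (hs : IsUnit (R₃ A B Q s).det) :
    R₂ A B Q s - R₁ A B Q s * initialHess A B Q s = -((R₃ A B Q s)⁻¹)ᵀ := by
  obtain ⟨h1, -, h3⟩ := R_symplectic A B hQ s
  have e : ((R₃ A B Q s)⁻¹)ᵀ * (R₃ A B Q s)ᵀ = 1 := by
    rw [← Matrix.transpose_mul, Matrix.mul_nonsing_inv _ hs, Matrix.transpose_one]
  have key : (R₃ A B Q s)ᵀ * (R₂ A B Q s - R₁ A B Q s * initialHess A B Q s) = -1 := by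
    rw [Matrix.mul_sub, ← Matrix.mul_assoc, ← h1, initialHess, Matrix.mul_assoc,
      ← Matrix.mul_assoc (R₃ A B Q s), Matrix.mul_nonsing_inv _ hs, Matrix.one_mul, ← h3]
    abel
  calc _ = ((R₃ A B Q s)⁻¹)ᵀ * (R₃ A B Q s)ᵀ *
        (R₂ A B Q s - R₁ A B Q s * initialHess A B Q s) := by rw [e, Matrix.one_mul]
    _ = _ := by rw [Matrix.mul_assoc, key, Matrix.mul_neg, Matrix.mul_one]

theorem inv_R₃_neg (hQ : Q.IsSymm) (hs : IsUnit (R₃ A B Q s).det) :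
    (R₃ A B Q (-s))⁻¹ = -((R₃ A B Q s)⁻¹)ᵀ := by
  refine Matrix.inv_eq_right_inv ?_
  rw [R₃_neg A B hQ, Matrix.neg_mul, Matrix.mul_neg, neg_neg, ← Matrix.transpose_mul,
    Matrix.nonsing_inv_mul _ hs, Matrix.transpose_one]

theorem isUnit_det_R₃_neg (hQ : Q.IsSymm) (hs : IsUnit (R₃ A B Q s).det) :
    IsUnit (R₃ A B Q (-s)).det := by
  rw [R₃_neg A B hQ, Matrix.det_neg, Matrix.det_transpose]
  exact (isUnit_iff_ne_zero.2 (by simp)).mul hs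

theorem R₃_mul_initialHess (hs : IsUnit (R₃ A B Q s).det) :
    R₃ A B Q s * initialHess A B Q s = R₄ A B Q s := by
  rw [initialHess, ← Matrix.mul_assoc, Matrix.mul_nonsing_inv _ hs, Matrix.one_mul]

/-- The extremals that vanish at time `s`, read at time `τ`. -/
theorem R₄_eq (hQ : Q.IsSymm) (hs : IsUnit (R₃ A B Q s).det) (τ : ℝ) :
    R₄ A B Q τ = R₃ A B Q τ * initialHess A B Q s + R₃ A B Q (τ - s) * (R₃ A B Q (-s))⁻¹ := by
  have e3 := R₃_add A B Q (τ - s) s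
  have e4 := R₄_add A B Q (τ - s) s
  rw [sub_add_cancel] at e3 e4
  rw [inv_R₃_neg hQ hs, ← R₂_sub_R₁_mul_initialHess hQ hs, e3, e4, Matrix.add_mul,
    Matrix.mul_assoc (R₄ A B Q (τ - s)), R₃_mul_initialHess hs, Matrix.mul_sub, Matrix.mul_assoc]
  abel

theorem hasDerivAt_initialHess (hQ : Q.IsSymm) (hs : IsUnit (R₃ A B Q s).det) :
    HasDerivAt (initialHess A B Q)
      (-(((R₃ A B Q s)⁻¹ * B) * ((R₃ A B Q s)⁻¹ * B)ᵀ)) s := by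
  refine ((hasDerivAt_matrix_inv (hasDerivAt_R₃ A B Q s) hs).mul
    (hasDerivAt_R₄ A B Q s)).congr_deriv ?_
  have e := R₂_sub_R₁_mul_initialHess hQ hs
  have e2 := Matrix.mul_nonsing_inv _ hs
  have e3 : (R₃ A B Q s)⁻¹ * B * ((R₃ A B Q s)⁻¹ * B)ᵀ
      = -((R₃ A B Q s)⁻¹ * B * Bᵀ * -((R₃ A B Q s)⁻¹)ᵀ) := by
    rw [Matrix.transpose_mul, Matrix.mul_neg, neg_neg]; simp only [Matrix.mul_assoc]
  rw [e3, ← e, initialHess]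
  have e4 : (R₃ A B Q s)⁻¹ * (A * R₃ A B Q s) * (R₃ A B Q s)⁻¹ = (R₃ A B Q s)⁻¹ * A := by
    rw [Matrix.mul_assoc, Matrix.mul_assoc A, e2, Matrix.mul_one]
  rw [Matrix.mul_add, Matrix.add_mul, e4]
  simp only [Matrix.mul_add, Matrix.add_mul, Matrix.mul_sub, Matrix.neg_mul, Matrix.mul_assoc,
    neg_add, neg_sub]
  abel

/-- The Riccati equation. -/
theorem hasDerivAt_finalHess (hs : IsUnit (R₃ A B Q s).det) :
    HasDerivAt (finalHess A B Q) (-(Aᵀ * finalHess A B Q s) - Q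
      - finalHess A B Q s * (B * Bᵀ) * finalHess A B Q s - finalHess A B Q s * A) s := by
  refine ((hasDerivAt_R₁ A B Q s).mul
    (hasDerivAt_matrix_inv (hasDerivAt_R₃ A B Q s) hs)).congr_deriv ?_
  have e2 := Matrix.mul_nonsing_inv _ hs
  have e4 : (R₃ A B Q s)⁻¹ * (A * R₃ A B Q s) * (R₃ A B Q s)⁻¹ = (R₃ A B Q s)⁻¹ * A := by
    rw [Matrix.mul_assoc, Matrix.mul_assoc A, e2, Matrix.mul_one]
  rw [finalHess, Matrix.mul_add, Matrix.add_mul, e4, Matrix.sub_mul, Matrix.mul_assoc Q, e2]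
  simp only [Matrix.mul_add, Matrix.neg_mul, Matrix.mul_neg, Matrix.mul_assoc, neg_add,
    Matrix.mul_one]
  abel

end SingleTime

/-! ### Signs of the determinants -/

section Signs

variable {A B} {r : ℝ}

/-- The Hessian in the first variable decreases with the time: its derivative is
`-(R₃⁻¹ B) (R₃⁻¹ B)*`. -/
theorem posSemidef_initialHess_sub (hQ : Q.IsSymm)
    (hr : ∀ t ∈ Ioc 0 r, IsUnit (R₃ A B Q t).det) {τ s : ℝ} (hτ : 0 < τ) (hτs : τ ≤ s)
    (hs : s ≤ r) : (initialHess A B Q τ - initialHess A B Q s).PosSemidef := by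
  have hτr := hr τ ⟨hτ, hτs.trans hs⟩
  have hsr := hr s ⟨hτ.trans_le hτs, hs⟩
  refine posSemidef_of_inner ((isSymm_initialHess hQ hτr).sub (isSymm_initialHess hQ hsr))
    fun x => ?_
  have hd : ∀ t ∈ Ioc 0 r, HasDerivAt (fun t => inner ℝ (act (initialHess A B Q t) x) x)
      (-‖act ((R₃ A B Q t)⁻¹ * B)ᵀ x‖ ^ 2) t := fun t ht => by
    refine ((hasDerivAt_act_const (hasDerivAt_initialHess hQ (hr t ht)) x).inner ℝ
      (hasDerivAt_const t x)).congr_deriv ?_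
    rw [inner_zero_right, zero_add, neg_act, inner_neg_left, act_mul, inner_act_left,
      real_inner_self_eq_norm_sq]
  have hanti : AntitoneOn (fun t => inner ℝ (act (initialHess A B Q t) x) x) (Ioc 0 r) := by
    refine antitoneOn_of_deriv_nonpos (convex_Ioc 0 r)
      (fun t ht => (hd t ht).continuousAt.continuousWithinAt)
      (fun t ht => (hd t (interior_subset ht)).differentiableAt.differentiableWithinAt)
      fun t ht => ?_
    rw [(hd t (interior_subset ht)).deriv]
    simp
  have := hanti ⟨hτ, hτs.trans hs⟩ ⟨hτ.trans_le hτs, hs⟩ hτs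
  rw [sub_act, inner_sub_left]
  simpa using this

theorem R₃_mul_initialHess_sub (hQ : Q.IsSymm) {τ s : ℝ} (hτ : IsUnit (R₃ A B Q τ).det)
    (hs : IsUnit (R₃ A B Q s).det) :
    R₃ A B Q τ * (initialHess A B Q τ - initialHess A B Q s)
      = R₃ A B Q (τ - s) * (R₃ A B Q (-s))⁻¹ := by
  rw [Matrix.mul_sub, R₃_mul_initialHess hτ, R₄_eq hQ hs τ]
  abel

theorem posDef_initialHess_sub (hQ : Q.IsSymm)
    (hr : ∀ t ∈ Ioc 0 r, IsUnit (R₃ A B Q t).det) {τ s : ℝ} (hτ : 0 < τ) (hτs : τ < s)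
    (hs : s ≤ r) : (initialHess A B Q τ - initialHess A B Q s).PosDef := by
  have hτr := hr τ ⟨hτ, hτs.le.trans hs⟩
  have hsr := hr s ⟨hτ.trans hτs, hs⟩
  refine (posSemidef_initialHess_sub hQ hr hτ hτs.le hs).posDef_iff_isUnit.2 ?_
  have e := congrArg Matrix.det (R₃_mul_initialHess_sub hQ hτr hsr)
  have h1 : IsUnit (R₃ A B Q (τ - s)).det := by
    have := isUnit_det_R₃_neg hQ (hr (s - τ) ⟨by linarith, by linarith⟩)
    rwa [neg_sub] at this
  have h2 := Matrix.isUnit_nonsing_inv_det _ (isUnit_det_R₃_neg hQ hsr)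
  rw [Matrix.det_mul, Matrix.det_mul] at e
  rw [Matrix.isUnit_iff_isUnit_det]
  exact isUnit_of_mul_isUnit_right (e ▸ h1.mul h2)

/-- If `G + R₃(s)⁻¹ R₄(s)` is positive semidefinite, the determinant of `R₃ G + R₄` has no zero on
`[0, s)`, hence the sign of its value at `0`, which is `1`. -/
theorem det_R₃_mul_add_R₄_pos (hQ : Q.IsSymm)
    (hr : ∀ t ∈ Ioc 0 r, IsUnit (R₃ A B Q t).det) {G : Matrix (Fin n) (Fin n) ℝ} {s : ℝ}
    (hs : s ≤ r) (hG : (G + initialHess A B Q s).PosSemidef) {τ : ℝ} (hτ : τ ∈ Ico 0 s) :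
    0 < (R₃ A B Q τ * G + R₄ A B Q τ).det := by
  have hne : ∀ t ∈ Ico 0 s, (R₃ A B Q t * G + R₄ A B Q t).det ≠ 0 := fun t ht => by
    rcases ht.1.eq_or_lt with rfl | h0
    · simp [R₃_zero, R₄_zero]
    have htr := hr t ⟨h0, ht.2.le.trans hs⟩
    have e : R₃ A B Q t * G + R₄ A B Q t = R₃ A B Q t *
        ((initialHess A B Q t - initialHess A B Q s) + (G + initialHess A B Q s)) := by
      rw [← R₃_mul_initialHess htr, ← Matrix.mul_add]; congr 1; abel
    rw [e, Matrix.det_mul]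
    exact mul_ne_zero htr.ne_zero
      ((posDef_initialHess_sub hQ hr h0 ht.2 hs).add_posSemidef hG).det_pos.ne'
  have hc : Continuous fun t => (R₃ A B Q t * G + R₄ A B Q t).det :=
    (((continuous_R₃ A B Q).matrix_mul continuous_const).add (continuous_R₄ A B Q)).matrix_det
  by_contra! hle
  have h0 : (0 : ℝ) ∈ Icc (R₃ A B Q τ * G + R₄ A B Q τ).det (R₃ A B Q 0 * G + R₄ A B Q 0).det :=
    ⟨hle, by simp [R₃_zero, R₄_zero]⟩
  obtain ⟨t, ht, ht0⟩ := intermediate_value_Icc' hτ.1 hc.continuousOn h0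
  exact hne t ⟨ht.1, ht.2.trans_lt hτ.2⟩ ht0

theorem det_R₃_pos (hQ : Q.IsSymm)
    (hr : ∀ t ∈ Ioc 0 r, IsUnit (R₃ A B Q t).det) {τ : ℝ} (hτ : τ ∈ Ioo 0 r) :
    0 < (R₃ A B Q τ).det := by
  have hr0 : r ∈ Ioc 0 r := ⟨hτ.1.trans hτ.2, le_rfl⟩
  have hτr : τ ∈ Ioc 0 r := ⟨hτ.1, hτ.2.le⟩
  have h := det_R₃_mul_add_R₄_pos hQ hr (G := -initialHess A B Q r) (s := r) le_rfl
    (by rw [neg_add_cancel]; exact Matrix.PosSemidef.zero) ⟨hτ.1.le, hτ.2⟩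
  rw [← R₃_mul_initialHess (hr τ hτr), ← Matrix.mul_add, Matrix.det_mul, neg_add_eq_sub] at h
  exact (pos_iff_pos_of_mul_pos h).2 (posDef_initialHess_sub hQ hr hτ.1 hτ.2 le_rfl).det_pos

theorem det_R₃_neg_div (hQ : Q.IsSymm) {τ s : ℝ} :
    (R₃ A B Q (τ - s)).det / (R₃ A B Q (-s)).det
      = (R₃ A B Q (s - τ)).det / (R₃ A B Q s).det := by
  rw [← neg_sub s τ, R₃_neg A B hQ, R₃_neg A B hQ s, Matrix.det_neg, Matrix.det_neg,
    Matrix.det_transpose, Matrix.det_transpose, mul_div_mul_left _ _ (by simp)]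

end Signs

/-! ### The determinant inequality -/

/-- The determinant inequality for the matrices `R₃ G + R₄`: they decompose as
`R₃(τ) ((K(τ) - K(s)) + (G + K(s)))`, where `K = R₃⁻¹ R₄` and both summands are positive
semidefinite, so that Minkowski's inequality applies. -/
theorem nthRoot_det_le {A : Matrix (Fin n) (Fin n) ℝ} {B : Matrix (Fin n) (Fin m) ℝ} {r : ℝ}
    (hn : 1 ≤ n) (hQ : Q.IsSymm)
    (hr : ∀ t ∈ Ioc 0 r, IsUnit (R₃ A B Q t).det) {G : Matrix (Fin n) (Fin n) ℝ} {s τ : ℝ}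
    (hs : s ∈ Ioc 0 r) (hτ : τ ∈ Icc 0 s) (hG : (G + initialHess A B Q s).PosSemidef) :
    nthRoot n (R₃ A B Q (τ - s)).det / nthRoot n (R₃ A B Q (-s)).det
        + nthRoot n (R₃ A B Q τ).det / nthRoot n (R₃ A B Q s).det
          * nthRoot n (R₃ A B Q s * G + R₄ A B Q s).det
      ≤ nthRoot n (R₃ A B Q τ * G + R₄ A B Q τ).det := by
  have : Nonempty (Fin n) := ⟨⟨0, hn⟩⟩
  have hsr := hr s hs
  have hsn := isUnit_det_R₃_neg hQ hsr
  have hJs : R₃ A B Q s * G + R₄ A B Q s = R₃ A B Q s * (G + initialHess A B Q s) := by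
    rw [← R₃_mul_initialHess hsr, Matrix.mul_add]
  rw [hJs, Matrix.det_mul, nthRoot_mul, div_mul_eq_mul_div, mul_left_comm,
    mul_div_cancel_left₀ _ (nthRoot_ne_zero n hsr.ne_zero)]
  rcases hτ.1.eq_or_lt with rfl | h0
  · rw [R₃_zero, R₄_zero, Matrix.det_zero, nthRoot_zero, zero_sub,
      div_self (nthRoot_ne_zero n hsn.ne_zero), Matrix.zero_mul,
      zero_mul, zero_add, add_zero, Matrix.det_one, nthRoot_one]
  have hτ' : τ ∈ Ioc 0 r := ⟨h0, hτ.2.trans hs.2⟩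
  have hJτ : R₃ A B Q τ * G + R₄ A B Q τ = R₃ A B Q τ *
      ((initialHess A B Q τ - initialHess A B Q s) + (G + initialHess A B Q s)) := by
    rw [← R₃_mul_initialHess (hr τ hτ'), ← Matrix.mul_add]; congr 1; abel
  rcases hτ.2.eq_or_lt with rfl | hτs
  · rw [hJτ, sub_self, R₃_zero, Matrix.det_zero, nthRoot_zero, zero_div, zero_add, sub_self, zero_add,
      Matrix.det_mul, nthRoot_mul]
  have hfirst : nthRoot n (R₃ A B Q (τ - s)).det / nthRoot n (R₃ A B Q (-s)).det
      = nthRoot n (R₃ A B Q τ).det *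
        nthRoot n (initialHess A B Q τ - initialHess A B Q s).det := by
    rw [← nthRoot_div _ _ hsn.ne_zero, ← nthRoot_mul, ← Matrix.det_mul,
      R₃_mul_initialHess_sub hQ (hr τ hτ') hsr, Matrix.det_mul, Matrix.det_nonsing_inv,
      Ring.inverse_eq_inv', div_eq_mul_inv]
  rw [hfirst, ← mul_add, hJτ, Matrix.det_mul, nthRoot_mul]
  have hpos : 0 < (R₃ A B Q τ).det :=
    det_R₃_pos hQ hr ⟨h0, hτs.trans_le hs.2⟩
  exact mul_le_mul_of_nonneg_left
    (nthRoot_det_add_le hn (posDef_initialHess_sub hQ hr h0 hτs hs.2) hG) (nthRoot_nonneg hpos.le)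

end Riccati

/-! ### Absolutely continuous functions -/

section AbsolutelyContinuous

variable {F G H : Type*} [NormedAddCommGroup F] [NormedSpace ℝ F] [NormedAddCommGroup G]
  [NormedSpace ℝ G] [NormedAddCommGroup H] [NormedSpace ℝ H]

open AbsolutelyContinuousOnInterval in
theorem _root_.AbsolutelyContinuousOnInterval.bilin (b : F →L[ℝ] G →L[ℝ] H) {f : ℝ → F} {g : ℝ → G}
    {s t : ℝ} (hf : AbsolutelyContinuousOnInterval f s t)
    (hg : AbsolutelyContinuousOnInterval g s t) :
    AbsolutelyContinuousOnInterval (fun x => b (f x) (g x)) s t := by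
  obtain ⟨C, hC⟩ := hf.exists_bound
  obtain ⟨D, hD⟩ := hg.exists_bound
  unfold AbsolutelyContinuousOnInterval at hf hg
  apply squeeze_zero' ?_ ?_
    (by simpa using (hg.const_mul (‖b‖ * C)).add (hf.const_mul (‖b‖ * D)))
  · exact Filter.Eventually.of_forall <| fun _ ↦ Finset.sum_nonneg (fun i hi ↦ dist_nonneg)
  rw [eventually_inf_principal]
  filter_upwards with (n, I) hnI
  simp only [Finset.mul_sum, ← Finset.sum_add_distrib]
  refine Finset.sum_le_sum fun i hi => ?_
  simp only [disjWithin, mem_ofPred_eq] at hnI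
  have h1 := hC _ (hnI.left i hi |>.left)
  have h2 := hD _ (hnI.left i hi |>.right)
  have e : b (f (I i).1) (g (I i).1) - b (f (I i).2) (g (I i).2)
      = b (f (I i).1) (g (I i).1 - g (I i).2) + b (f (I i).1 - f (I i).2) (g (I i).2) := by
    simp only [map_sub, _root_.sub_apply]; abel
  rw [dist_eq_norm, dist_eq_norm, dist_eq_norm, e]
  refine (norm_add_le _ _).trans (add_le_add ((b.le_opNorm₂ _ _).trans ?_)
    ((b.le_opNorm₂ _ _).trans ?_))
  · gcongr
  · rw [mul_assoc, mul_assoc, mul_comm D]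
    gcongr

theorem absolutelyContinuousOnInterval_of_hasDerivAt {f f' : ℝ → F} {s t : ℝ} (hst : s ≤ t)
    (hf : ∀ x ∈ Icc s t, HasDerivAt f (f' x) x) (hf' : ContinuousOn f' (Icc s t)) :
    AbsolutelyContinuousOnInterval f s t := by
  obtain ⟨C, hC⟩ := isCompact_Icc.exists_bound_of_continuousOn hf'
  have h : LipschitzOnWith C.toNNReal f (uIcc s t) := by
    rw [uIcc_of_le hst]
    refine (convex_Icc s t).lipschitzOnWith_of_nnnorm_hasDerivWithin_le
      (fun x hx => (hf x hx).hasDerivWithinAt) fun x hx => ?_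
    rw [← NNReal.coe_le_coe, coe_nnnorm]
    exact (hC x hx).trans (Real.le_coe_toNNReal C)
  exact h.absolutelyContinuousOnInterval

theorem _root_.AbsolutelyContinuousOnInterval.inner {f g : ℝ → E n} {s t : ℝ}
    (hf : AbsolutelyContinuousOnInterval f s t) (hg : AbsolutelyContinuousOnInterval g s t) :
    AbsolutelyContinuousOnInterval (fun x => inner ℝ (f x) (g x)) s t :=
  hf.bilin (innerSL ℝ) hg

theorem _root_.AbsolutelyContinuousOnInterval.act {S : ℝ → Matrix (Fin n) (Fin n) ℝ}
    {ξ : ℝ → E n} {s t : ℝ} (hS : AbsolutelyContinuousOnInterval (fun x => actCLM (S x)) s t)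
    (hξ : AbsolutelyContinuousOnInterval ξ s t) :
    AbsolutelyContinuousOnInterval (fun x => act (S x) (ξ x)) s t :=
  hS.bilin (ContinuousLinearMap.id ℝ (E n →L[ℝ] E n)) hξ

end AbsolutelyContinuous

/-! ### Optimality of the extremals -/

section Optimality

open scoped Matrix Matrix.Norms.Operator

variable (A : Matrix (Fin n) (Fin n) ℝ) (B : Matrix (Fin n) (Fin m) ℝ)
  (Q : Matrix (Fin n) (Fin n) ℝ)

/-- The covector at time `τ` of the integral curve of the Hamiltonian system with initial datum
`(p, x)`. -/
noncomputable def momentum (τ : ℝ) (x p : E n) : E n :=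
  act (R₁ A B Q τ) p + act (R₂ A B Q τ) x

theorem hasDerivAt_momentum (x p : E n) (τ : ℝ) :
    HasDerivAt (fun t => momentum A B Q t x p)
      (-act Aᵀ (momentum A B Q τ x p) - act Q (expMap A B Q τ x p)) τ :=
  hasDerivAt_expMap_momentum A B Q x p τ

theorem continuous_momentum (x p : E n) : Continuous fun t => momentum A B Q t x p :=
  continuous_iff_continuousAt.2 fun τ => (hasDerivAt_momentum A B Q x p τ).continuousAt

theorem continuous_expMap (x p : E n) : Continuous fun t => expMap A B Q t x p :=
  continuous_iff_continuousAt.2 fun τ => (hasDerivAt_expMap A B Q x p τ).continuousAt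

theorem expMap_zero (x p : E n) : expMap A B Q 0 x p = x := by
  rw [expMap, R₃_zero, R₄_zero, zero_act, act_one, zero_add]

theorem momentum_zero (x p : E n) : momentum A B Q 0 x p = p := by
  rw [momentum, R₁_zero, R₂_zero, zero_act, act_one, add_zero]

variable {T : ℝ}

theorem isAdmissible_expMap (hT : 0 ≤ T) (x p : E n) :
    IsAdmissible A B T (fun τ => expMap A B Q τ x p)
      (fun τ => act Bᵀ (momentum A B Q τ x p)) where
  memLp := by
    have hc : Continuous fun τ => act Bᵀ (momentum A B Q τ x p) :=
      (continuous_act _).comp (continuous_momentum A B Q x p)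
    obtain ⟨C, hC⟩ := isCompact_Icc.exists_bound_of_continuousOn (hc.continuousOn (s := Icc 0 T))
    exact MemLp.of_bound hc.aestronglyMeasurable C
      ((ae_restrict_iff' measurableSet_Icc).2 (.of_forall hC))
  absolutelyContinuous :=
    absolutelyContinuousOnInterval_of_hasDerivAt hT (fun τ _ => hasDerivAt_expMap A B Q x p τ)
      (((continuous_act _).comp (continuous_momentum A B Q x p)).add
        ((continuous_act _).comp (continuous_expMap A B Q x p))).continuousOn
  ode := .of_forall fun τ => (hasDerivAt_expMap A B Q x p τ).congr_deriv (by
    rw [act_mul, add_comm]; rfl)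

variable {Q}

/-- The action of an extremal: along it the Lagrangian is the derivative of the pairing of covector
and position. -/
theorem action_expMap (x p : E n) (hQ : Q.IsSymm) :
    action Q T (fun τ => expMap A B Q τ x p) (fun τ => act Bᵀ (momentum A B Q τ x p))
      = (1 / 2) * (inner ℝ (momentum A B Q T x p) (expMap A B Q T x p) - inner ℝ p x) := by
  have hd : ∀ τ, HasDerivAt (fun t => inner ℝ (momentum A B Q t x p) (expMap A B Q t x p))
      (‖act Bᵀ (momentum A B Q τ x p)‖ ^ 2
        - inner ℝ (expMap A B Q τ x p) (act Q (expMap A B Q τ x p))) τ := fun τ => by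
    refine ((hasDerivAt_momentum A B Q x p τ).inner ℝ (hasDerivAt_expMap A B Q x p τ)).congr_deriv
      ?_
    change inner ℝ (momentum A B Q τ x p) (act (B * Bᵀ) (momentum A B Q τ x p) +
      act A (expMap A B Q τ x p)) + _ = _
    rw [inner_add_right, inner_sub_left, inner_neg_left, act_mul, inner_act_right B,
      real_inner_self_eq_norm_sq, inner_act_right A, inner_act_right Q, hQ.eq]
    ring
  have hc1 : Continuous fun τ => act Bᵀ (momentum A B Q τ x p) :=
    (continuous_act _).comp (continuous_momentum A B Q x p)
  have hc2 := continuous_expMap A B Q x p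
  have hc3 : Continuous fun τ => act Q (expMap A B Q τ x p) := (continuous_act Q).comp hc2
  have hc : Continuous fun τ => ‖act Bᵀ (momentum A B Q τ x p)‖ ^ 2
      - inner ℝ (expMap A B Q τ x p) (act Q (expMap A B Q τ x p)) :=
    (hc1.norm.pow 2).sub (hc2.inner hc3)
  rw [action, intervalIntegral.integral_eq_sub_of_hasDerivAt (fun τ _ => hd τ)
    (hc.intervalIntegrable 0 T), expMap_zero, momentum_zero]

variable {A B}

theorem intervalIntegrable_lagrangian {γ : ℝ → E n} {u : ℝ → E m} (hT : 0 ≤ T)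
    (h : IsAdmissible A B T γ u) :
    IntervalIntegrable (fun τ => ‖u τ‖ ^ 2 - inner ℝ (γ τ) (act Q (γ τ))) volume 0 T := by
  have h1 : IntervalIntegrable (fun τ => ‖u τ‖ ^ 2) volume 0 T := by
    rw [intervalIntegrable_iff_integrableOn_Icc_of_le hT]
    exact h.memLp.norm.integrable_sq
  have h2 := h.absolutelyContinuous.continuousOn
  exact h1.sub (h2.inner ((continuous_act Q).comp_continuousOn h2)).intervalIntegrable

/-- Completion of the square along the field of extremals with a Riccati matrix `S`: the derivative
of `⟨2 p + S ξ, ξ⟩`, where `ξ` is the deviation from the extremal with covector `p`, is at most the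
difference of the Lagrangians. -/
theorem riccati_deriv_le {S : Matrix (Fin n) (Fin n) ℝ} (hS : S.IsSymm) (hQ : Q.IsSymm)
    (p γ η : E n) (v : E m) :
    inner ℝ ((2 : ℝ) • p + act S (η - γ)) (act A η + act B v - (act (B * Bᵀ) p + act A γ))
      + inner ℝ ((2 : ℝ) • (-act Aᵀ p - act Q γ)
        + (act (-(Aᵀ * S) - Q - S * (B * Bᵀ) * S - S * A) (η - γ)
          + act S (act A η + act B v - (act (B * Bᵀ) p + act A γ)))) (η - γ)
    ≤ (‖v‖ ^ 2 - inner ℝ η (act Q η)) - (‖act Bᵀ p‖ ^ 2 - inner ℝ γ (act Q γ)) := by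
  obtain ⟨ξ, rfl⟩ : ∃ ξ, η = γ + ξ := ⟨η - γ, by abel⟩
  obtain ⟨w, rfl⟩ : ∃ w, v = act Bᵀ p + w := ⟨v - act Bᵀ p, by abel⟩
  have e : act A (γ + ξ) + act B (act Bᵀ p + w) - (act (B * Bᵀ) p + act A γ)
      = act A ξ + act B w := by
    rw [act_add, act_add, act_mul]; abel
  rw [e, add_sub_cancel_left]
  have hsq := real_inner_self_nonneg (x := w - act Bᵀ (act S ξ))
  rw [inner_sub_left, inner_sub_right, inner_sub_right, real_inner_comm w] at hsq
  simp only [sub_act, neg_act, act_mul, act_add, inner_add_left, inner_add_right, inner_sub_left,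
    inner_neg_left, inner_smul_left, ← real_inner_self_eq_norm_sq, conj_trivial] at hsq ⊢
  have a1 : inner ℝ (act Aᵀ p) ξ = inner ℝ p (act A ξ) := by
    rw [inner_act_left, Matrix.transpose_transpose]
  have a2 : inner ℝ p (act B w) = inner ℝ (act Bᵀ p) w := inner_act_right B w p
  have a3 : inner ℝ (act S ξ) (act B w) = inner ℝ (act Bᵀ (act S ξ)) w := inner_act_right B w _
  have a4 : inner ℝ (act Aᵀ (act S ξ)) ξ = inner ℝ (act S ξ) (act A ξ) := by
    rw [inner_act_left, Matrix.transpose_transpose]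
  have a5 : inner ℝ (act S (act A ξ)) ξ = inner ℝ (act S ξ) (act A ξ) :=
    inner_act_self_comm hS _ _
  have a6 : inner ℝ (act S (act B w)) ξ = inner ℝ (act Bᵀ (act S ξ)) w := by
    rw [inner_act_self_comm hS, a3]
  have a7 : inner ℝ (act S (act B (act Bᵀ (act S ξ)))) ξ
      = inner ℝ (act Bᵀ (act S ξ)) (act Bᵀ (act S ξ)) := by
    rw [inner_act_self_comm hS, inner_act_right B]
  have a8 : inner ℝ γ (act Q ξ) = inner ℝ (act Q γ) ξ := by rw [inner_act_right, hQ.eq]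
  have a9 : inner ℝ ξ (act Q γ) = inner ℝ (act Q γ) ξ := real_inner_comm _ _
  have a10 : inner ℝ ξ (act Q ξ) = inner ℝ (act Q ξ) ξ := real_inner_comm _ _
  have a11 : inner ℝ w (act Bᵀ p) = inner ℝ (act Bᵀ p) w := real_inner_comm _ _
  have a12 : inner ℝ (act Bᵀ (act S ξ)) w = inner ℝ w (act Bᵀ (act S ξ)) := real_inner_comm _ _
  simp only [a1, a2, a3, a4, a5, a6, a7, a8, a9, a10, a11] at *
  linarith

/-- Extremals without conjugate points are optimal. The Riccati matrix is that of the extremals that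
vanish at a time slightly before `0`, so that it is regular on the whole of `[0, T]`; there is room
for this since conjugate points are absent up to a time `r > T`. -/
theorem action_expMap_le {r : ℝ} (hQ : Q.IsSymm)
    (hr : ∀ t ∈ Ioc 0 r, IsUnit (R₃ A B Q t).det) (hT : 0 ≤ T) (hTr : T < r) (x p : E n)
    {η : ℝ → E n} {v : ℝ → E m} (h : IsAdmissible A B T η v) (h0 : η 0 = x)
    (h1 : η T = expMap A B Q T x p) :
    action Q T (fun τ => expMap A B Q τ x p) (fun τ => act Bᵀ (momentum A B Q τ x p))
      ≤ action Q T η v := by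
  have hadm := isAdmissible_expMap A B Q hT x p
  have hmem : ∀ τ ∈ Icc 0 T, τ + (r - T) ∈ Ioc 0 r := fun τ hτ =>
    ⟨by linarith [hτ.1], by linarith [hτ.2]⟩
  set S : ℝ → Matrix (Fin n) (Fin n) ℝ := fun τ => finalHess A B Q (τ + (r - T)) with hS
  have hSd : ∀ τ ∈ Icc 0 T, HasDerivAt S
      (-(Aᵀ * S τ) - Q - S τ * (B * Bᵀ) * S τ - S τ * A) τ := fun τ hτ =>
    (hasDerivAt_finalHess (hr _ (hmem τ hτ))).comp_add_const τ (r - T)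
  have hSc : ContinuousOn S (Icc 0 T) := fun τ hτ =>
    (hSd τ hτ).continuousAt.continuousWithinAt
  have hSac : AbsolutelyContinuousOnInterval (fun τ => actCLM (S τ)) 0 T := by
    let L : Matrix (Fin n) (Fin n) ℝ →L[ℝ] (E n →L[ℝ] E n) := ⟨actCLM, continuous_actCLM⟩
    refine absolutelyContinuousOnInterval_of_hasDerivAt hT
      (f' := fun τ => actCLM (-(Aᵀ * S τ) - Q - S τ * (B * Bᵀ) * S τ - S τ * A))
      (fun τ hτ => L.hasFDerivAt.comp_hasDerivAt τ (hSd τ hτ)) ?_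
    refine continuous_actCLM.comp_continuousOn ?_
    fun_prop
  have hpac : AbsolutelyContinuousOnInterval (fun τ => (2 : ℝ) • momentum A B Q τ x p) 0 T := by
    refine (absolutelyContinuousOnInterval_of_hasDerivAt hT
      (fun τ _ => hasDerivAt_momentum A B Q x p τ) ?_).const_smul 2
    exact (((continuous_act _).comp (continuous_momentum A B Q x p)).neg.sub
        ((continuous_act _).comp (continuous_expMap A B Q x p))).continuousOn
  have hξac : AbsolutelyContinuousOnInterval (fun τ => η τ - expMap A B Q τ x p) 0 T :=
    h.absolutelyContinuous.sub hadm.absolutelyContinuous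
  set F : ℝ → ℝ := fun τ => inner ℝ ((2 : ℝ) • momentum A B Q τ x p
    + act (S τ) (η τ - expMap A B Q τ x p)) (η τ - expMap A B Q τ x p) with hF
  have hFac : AbsolutelyContinuousOnInterval F 0 T :=
    (hpac.fun_add (hSac.act hξac)).inner hξac
  have hint := hFac.integral_deriv_eq_sub
  have hF0 : F 0 = 0 := by simp [hF, h0, expMap_zero]
  have hFT : F T = 0 := by simp [hF, h1]
  rw [hF0, hFT, sub_zero] at hint
  have hL := intervalIntegrable_lagrangian (Q := Q) hT h
  have hL' := intervalIntegrable_lagrangian (Q := Q) hT hadm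
  have hle : ∀ᵐ τ ∂(volume.restrict (Icc 0 T)), deriv F τ ≤
      (‖v τ‖ ^ 2 - inner ℝ (η τ) (act Q (η τ))) - (‖act Bᵀ (momentum A B Q τ x p)‖ ^ 2
        - inner ℝ (expMap A B Q τ x p) (act Q (expMap A B Q τ x p))) := by
    filter_upwards [h.ode, ae_restrict_mem measurableSet_Icc] with τ hτ hτT
    have hξ := hτ.fun_sub (hasDerivAt_expMap A B Q x p τ)
    have hd := (((hasDerivAt_momentum A B Q x p τ).fun_const_smul (2 : ℝ)).fun_add
      (hasDerivAt_act (hSd τ hτT) hξ)).inner ℝ hξ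
    have hSs : (S τ).IsSymm := isSymm_finalHess hQ (hr _ (hmem τ hτT))
    rw [hd.deriv]
    exact riccati_deriv_le hSs hQ (momentum A B Q τ x p) (expMap A B Q τ x p) (η τ) (v τ)
  have hmono := intervalIntegral.integral_mono_ae_restrict hT hFac.intervalIntegrable_deriv
    (hL.sub hL') hle
  rw [hint, intervalIntegral.integral_sub hL hL'] at hmono
  rw [action, action]
  linarith

/-- Extremals without conjugate points realize the cost between their endpoints. -/
theorem cost_expMap {r : ℝ} (hQ : Q.IsSymm)
    (hr : ∀ t ∈ Ioc 0 r, IsUnit (R₃ A B Q t).det) (hT : 0 ≤ T) (hTr : T < r) (x p : E n) :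
    cost A B Q T x (expMap A B Q T x p) =
      action Q T (fun τ => expMap A B Q τ x p) (fun τ => act Bᵀ (momentum A B Q τ x p)) := by
  refine IsLeast.csInf_eq ⟨⟨_, _, isAdmissible_expMap A B Q hT x p, expMap_zero A B Q x p, rfl,
    rfl⟩, ?_⟩
  rintro a ⟨η, v, h, h0, h1, rfl⟩
  exact action_expMap_le hQ hr hT hTr x p h h0 h1

theorem isOptimalTrajectory_expMap {r : ℝ} (hQ : Q.IsSymm)
    (hr : ∀ t ∈ Ioc 0 r, IsUnit (R₃ A B Q t).det) (hT : 0 ≤ T) (hTr : T < r) (x p : E n) :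
    IsOptimalTrajectory A B Q T fun τ => expMap A B Q τ x p := by
  refine ⟨fun τ => act Bᵀ (momentum A B Q τ x p), isAdmissible_expMap A B Q hT x p,
    fun η v h h0 h1 => ?_, ?_⟩
  · exact action_expMap_le hQ hr hT hTr x p h (h0.trans (expMap_zero A B Q x p)) h1
  · change _ = cost A B Q T (expMap A B Q 0 x p) (expMap A B Q T x p)
    rw [expMap_zero]
    exact (cost_expMap hQ hr hT hTr x p).symm

/-- The cost is a quadratic form, whose mixed term is given by `R₃⁻¹`. -/
theorem cost_eq {r : ℝ} (hQ : Q.IsSymm)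
    (hr : ∀ t ∈ Ioc 0 r, IsUnit (R₃ A B Q t).det) (hT : 0 < T) (hTr : T < r) (x y : E n) :
    cost A B Q T x y = (1 / 2) * inner ℝ (act (finalHess A B Q T) y) y
      - inner ℝ (act (R₃ A B Q T)⁻¹ y) x + (1 / 2) * inner ℝ (act (initialHess A B Q T) x) x := by
  have hu := hr T ⟨hT, hTr.le⟩
  set p := act (R₃ A B Q T)⁻¹ (y - act (R₄ A B Q T) x) with hp
  have hy : expMap A B Q T x p = y := by
    rw [expMap, hp, ← act_mul, Matrix.mul_nonsing_inv _ hu, act_one]; abel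
  have hm : momentum A B Q T x p = act (finalHess A B Q T) y - act ((R₃ A B Q T)⁻¹)ᵀ x := by
    have := congrArg (fun M => act M x) (R₂_sub_R₁_mul_initialHess (A := A) (B := B) hQ hu)
    simp only [sub_act, neg_act, act_mul] at this
    rw [momentum, hp, finalHess, act_mul, sub_eq_add_neg (act _ _) (act _ x), ← this, act_sub,
      act_sub, ← act_mul _ (R₄ A B Q T), ← initialHess]
    abel
  have hp' : p = act (R₃ A B Q T)⁻¹ y - act (initialHess A B Q T) x := by
    rw [hp, act_sub, ← act_mul, initialHess]
  have h := cost_expMap hQ hr hT.le hTr x p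
  rw [hy, action_expMap A B x p hQ, hy, hm, hp', inner_sub_left, inner_sub_left,
    inner_act_left ((R₃ A B Q T)⁻¹)ᵀ, Matrix.transpose_transpose,
    real_inner_comm (act (R₃ A B Q T)⁻¹ y) x] at h
  rw [h]; ring

end Optimality

/-! ### Convex functions -/

section Convex

theorem _root_.ConvexOn.add_fderiv_le {F : Type*} [NormedAddCommGroup F] [NormedSpace ℝ F]
    {s : Set F} {φ : F → ℝ} (hφ : ConvexOn ℝ s φ) {x y : F} (hx : x ∈ s) (hy : y ∈ s)
    {L : F →L[ℝ] ℝ} (hL : HasFDerivAt φ L x) : φ x + L (y - x) ≤ φ y := by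
  have hd : HasDerivAt (fun t : ℝ => φ (x + t • (y - x))) (L (y - x)) 0 := by
    have h1 : HasDerivAt (fun t : ℝ => x + t • (y - x)) (y - x) 0 := by
      simpa using ((hasDerivAt_id (0 : ℝ)).smul_const (y - x)).const_add x
    have h2 : HasFDerivAt φ L (x + (0 : ℝ) • (y - x)) := by simpa using hL
    exact h2.comp_hasDerivAt 0 h1
  have hlim := hd.tendsto_slope_zero_right
  have : L (y - x) ≤ φ y - φ x := by
    refine le_of_tendsto hlim ?_
    filter_upwards [Ioc_mem_nhdsGT (zero_lt_one' ℝ)] with t ht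
    have := hφ.2 hx hy (sub_nonneg.2 ht.2) ht.1.le (by ring)
    have e : (1 - t) • x + t • y = x + t • (y - x) := by
      rw [smul_sub, sub_smul, one_smul]; abel
    rw [e] at this
    simp only [zero_add, zero_smul, add_zero, smul_eq_mul] at this ⊢
    rw [inv_mul_le_iff₀ ht.1]
    linarith
  linarith

/-- A convex function is differentiable almost everywhere in the interior of its domain, by
Rademacher's theorem. -/
theorem _root_.ConvexOn.ae_differentiableAt {s : Set (E n)} {φ : E n → ℝ} (hφ : ConvexOn ℝ s φ) :
    ∀ᵐ z, z ∈ interior s → DifferentiableAt ℝ φ z := by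
  have hl := hφ.locallyLipschitzOn_interior
  have h0 : volume {z | z ∈ interior s ∧ ¬ DifferentiableAt ℝ φ z} = 0 := by
    refine measure_null_of_locally_null _ fun x hx => ?_
    obtain ⟨K, t, ht, hKt⟩ := hl hx.1
    have ht' : t ∈ 𝓝 x := by rwa [isOpen_interior.nhdsWithin_eq hx.1] at ht
    refine ⟨interior t ∩ {z | ¬ DifferentiableAt ℝ φ z}, ?_, ?_⟩
    · refine mem_nhdsWithin.2 ⟨interior t, isOpen_interior, mem_interior_iff_mem_nhds.2 ht',
        fun z hz => ⟨hz.1, hz.2.2⟩⟩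
    · refine measure_mono_null ?_ hKt.ae_differentiableWithinAt_of_mem
      rintro z ⟨hz, hz'⟩ hcon
      exact hz' ((hcon (interior_subset hz)).differentiableAt (mem_interior_iff_mem_nhds.1 hz))
  filter_upwards [measure_eq_zero_iff_ae_notMem.1 h0] with z hz hz'
  by_contra hcon
  exact hz ⟨hz', hcon⟩

variable {s : Set (E n)} {φ : E n → ℝ} {x p : E n} {S : Matrix (Fin n) (Fin n) ℝ}

/-- The Hessian of a convex function at a point of second order expansion is positive
semidefinite. -/
theorem posSemidef_of_expansion (hS : S.IsSymm)
    (hsub : ∀ᶠ h in 𝓝 (0 : E n), φ x + inner ℝ p h ≤ φ (x + h))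
    (hexp : (fun h : E n => φ (x + h) - φ x - inner ℝ p h - (1 / 2) * inner ℝ (act S h) h)
      =o[𝓝 0] fun h : E n => ‖h‖ ^ 2) : S.PosSemidef := by
  refine posSemidef_of_inner hS fun v => ?_
  have key : ∀ ε > 0, 0 ≤ (1 / 2) * inner ℝ (act S v) v + ε * ‖v‖ ^ 2 := fun ε hε => by
    have hev := hsub.and (hexp.def hε)
    have ht : Tendsto (fun t : ℝ => t • v) (𝓝[>] 0) (𝓝 0) := by
      have : Continuous fun t : ℝ => t • v := by fun_prop
      have h := this.tendsto 0
      rw [zero_smul] at h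
      exact h.mono_left nhdsWithin_le_nhds
    obtain ⟨t, ⟨h1, h2⟩, ht0⟩ := ((ht.eventually hev).and self_mem_nhdsWithin).exists
    have ht0 : 0 < t := ht0
    rw [act_smul, inner_smul_left, inner_smul_right, inner_smul_right, norm_smul] at h2
    rw [inner_smul_right] at h1
    simp only [Real.norm_eq_abs, conj_trivial, mul_pow, sq_abs, abs_mul, abs_pow, abs_norm] at h2
    have h3 := (le_abs_self _).trans h2
    have h4 : 0 ≤ t ^ 2 * ((1 / 2) * inner ℝ (act S v) v + ε * ‖v‖ ^ 2) := by nlinarith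
    exact nonneg_of_mul_nonneg_right h4 (by positivity)
  by_contra! hneg
  rcases eq_or_ne v 0 with rfl | hv
  · simp at hneg
  have hv' : 0 < ‖v‖ ^ 2 := by positivity
  have := key (-inner ℝ (act S v) v / (4 * ‖v‖ ^ 2)) (div_pos (by linarith) (by positivity))
  have e : -inner ℝ (act S v) v / (4 * ‖v‖ ^ 2) * ‖v‖ ^ 2 = -inner ℝ (act S v) v / 4 := by
    field_simp
  rw [e] at this
  linarith

/-- At a point of second order expansion, the subgradients of a convex function have a first order
expansion, whose linear part is the Hessian: compare the values at `x + h` and at the point reached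
from there by a step of length comparable to, but much smaller than, `‖h‖` in the direction of the
error. -/
theorem norm_subgradient_sub_le (hS : S.IsSymm) (hs : s ∈ 𝓝 x)
    (hexp : (fun h : E n => φ (x + h) - φ x - inner ℝ p h - (1 / 2) * inner ℝ (act S h) h)
      =o[𝓝 0] fun h : E n => ‖h‖ ^ 2) {ε : ℝ} (hε : 0 < ε) :
    ∀ᶠ h in 𝓝 (0 : E n), h ≠ 0 → ∀ q : E n,
      (∀ y ∈ s, φ (x + h) + inner ℝ q (y - (x + h)) ≤ φ y) → ‖q - p - act S h‖ ≤ ε * ‖h‖ := by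
  set L := ‖actCLM S‖
  have hL : 0 ≤ L := norm_nonneg _
  -- `κ` is the ratio of the auxiliary step to `‖h‖`; the relative error `ε * κ / 16` in the
  -- expansion below is small compared with it.
  obtain ⟨κ, hκ0, hκ1, hκL⟩ : ∃ κ : ℝ, 0 < κ ∧ κ ≤ 1 ∧ κ * L ≤ ε := by
    refine ⟨min 1 (ε / (L + 1)), lt_min one_pos (by positivity), min_le_left _ _, ?_⟩
    calc min 1 (ε / (L + 1)) * L ≤ ε / (L + 1) * L := by gcongr; exact min_le_right _ _
      _ ≤ ε / (L + 1) * (L + 1) := by gcongr; linarith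
      _ = ε := by field_simp
  have hη : 0 < ε * κ / 16 := by positivity
  have hs' : ∀ᶠ h in 𝓝 (0 : E n), x + h ∈ s := by
    have : Tendsto (fun h : E n => x + h) (𝓝 0) (𝓝 x) := by
      simpa using (continuous_const_add x).tendsto (0 : E n)
    exact this.eventually hs
  obtain ⟨δ, hδ, hball⟩ := Metric.eventually_nhds_iff_ball.1 (hs'.and (hexp.def hη))
  refine Metric.eventually_nhds_iff_ball.2 ⟨δ / 2, by positivity, fun h hh h0 q hq => ?_⟩
  rw [mem_ball_zero_iff] at hh
  have hh0 : 0 < ‖h‖ := norm_pos_iff.2 h0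
  set v := q - p - act S h with hv
  rcases eq_or_ne v 0 with hv0 | hv0
  · rw [hv0, norm_zero]; positivity
  have hvn : 0 < ‖v‖ := norm_pos_iff.2 hv0
  set k : E n := (κ * ‖h‖ / ‖v‖) • v with hk
  have hkn : ‖k‖ = κ * ‖h‖ := by
    rw [hk, norm_smul, Real.norm_of_nonneg (by positivity)]; field_simp
  have hk1 : ‖k‖ ≤ ‖h‖ := by rw [hkn]; nlinarith
  have hhk : ‖h + k‖ ≤ 2 * ‖h‖ := (norm_add_le _ _).trans (by linarith)
  obtain ⟨-, b1⟩ := hball h (by rw [mem_ball_zero_iff]; linarith)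
  obtain ⟨m2, b2⟩ := hball (h + k) (by rw [mem_ball_zero_iff]; linarith)
  have hsub := hq _ m2
  rw [← add_assoc, add_sub_cancel_left] at hsub
  rw [← add_assoc] at b2
  have c1 := (abs_le.1 ((Real.norm_eq_abs _).symm.le.trans b1)).1
  have c2 := (abs_le.1 ((Real.norm_eq_abs _).symm.le.trans b2)).2
  rw [Real.norm_of_nonneg (by positivity)] at c1 c2
  have hSk : inner ℝ (act S k) k ≤ L * ‖k‖ ^ 2 := by
    calc inner ℝ (act S k) k ≤ ‖act S k‖ * ‖k‖ := real_inner_le_norm _ _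
      _ ≤ L * ‖k‖ * ‖k‖ := by
        gcongr
        exact (actCLM S).le_opNorm k
      _ = _ := by ring
  have hvk : inner ℝ v k = κ * ‖h‖ * ‖v‖ := by
    rw [hk, inner_smul_right, real_inner_self_eq_norm_sq]; field_simp
  rw [hv, inner_sub_left, inner_sub_left] at hvk
  rw [act_add, inner_add_left, inner_add_right, inner_add_right, inner_add_right,
    inner_act_self_comm hS k h] at c2
  have hsq : ‖h + k‖ ^ 2 ≤ 4 * ‖h‖ ^ 2 := by
    calc ‖h + k‖ ^ 2 ≤ (2 * ‖h‖) ^ 2 := by gcongr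
      _ = _ := by ring
  have d1 : ε * κ / 16 * ‖h + k‖ ^ 2 ≤ ε * κ / 16 * (4 * ‖h‖ ^ 2) := by gcongr
  have d2 : L * ‖k‖ ^ 2 ≤ ε * κ * ‖h‖ ^ 2 := by
    rw [hkn]
    calc L * (κ * ‖h‖) ^ 2 = (κ * L) * κ * ‖h‖ ^ 2 := by ring
      _ ≤ ε * κ * ‖h‖ ^ 2 := by gcongr
  have hfin : (κ * ‖h‖) * ‖v‖ ≤ (κ * ‖h‖) * (ε * ‖h‖) := by
    have : 0 ≤ ε * κ * ‖h‖ ^ 2 := by positivity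
    nlinarith
  exact le_of_mul_le_mul_left hfin (by positivity)

theorem hasGradientAt_of_expansion {f : E n → ℝ}
    (hexp : (fun h : E n => f (x + h) - f x - inner ℝ p h - (1 / 2) * inner ℝ (act S h) h)
      =o[𝓝 0] fun h : E n => ‖h‖ ^ 2) : HasGradientAt f p x := by
  rw [hasGradientAt_iff_hasFDerivAt, hasFDerivAt_iff_isLittleO_nhds_zero]
  have h1 : (fun h : E n => ‖h‖ ^ 2) =o[𝓝 0] fun h : E n => h := isLittleO_norm_pow_id one_lt_two
  have h2 : (fun h : E n => (1 / 2) * inner ℝ (act S h) h) =O[𝓝 0] fun h : E n => ‖h‖ ^ 2 := by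
    refine IsBigO.of_bound (1 / 2 * ‖actCLM S‖) (.of_forall fun h => ?_)
    rw [norm_mul, norm_pow, norm_norm, Real.norm_of_nonneg (by norm_num : (0 : ℝ) ≤ 1 / 2),
      mul_assoc, pow_two, ← mul_assoc ‖actCLM S‖]
    gcongr
    refine (norm_inner_le_norm _ _).trans ?_
    gcongr
    exact (actCLM S).le_opNorm h
  refine ((hexp.trans h1).add (h2.trans_isLittleO h1)).congr_left fun h => ?_
  simp [InnerProductSpace.toDual_apply_apply]

end Convex

/-! ### Potentials for quadratic costs -/

section Potential

variable {c : E n → E n → ℝ} {ψ : E n → EReal} {a : E n → ℝ} {M K : Matrix (Fin n) (Fin n) ℝ}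

theorem IsCConvex.ne_bot (hψ : IsCConvex c ψ) (x : E n) : ψ x ≠ ⊥ := by
  obtain ⟨-, S, ⟨q, hq⟩, h⟩ := hψ
  have : ((q.2 - c x q.1 : ℝ) : EReal) ≤ ψ x := by
    rw [h]; exact le_iSup₂ (f := fun (q : E n × ℝ) (_ : q ∈ S) => ((q.2 - c x q.1 : ℝ) : EReal)) q hq
  exact ((EReal.bot_lt_coe _).trans_le this).ne'

theorem IsCConvex.measurable (hψ : IsCConvex c ψ) (hc : ∀ y, Continuous fun x => c x y) :
    Measurable ψ := by
  obtain ⟨-, S, -, h⟩ := hψ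
  have : ψ = fun x => ⨆ q ∈ S, ((q.2 - c x q.1 : ℝ) : EReal) := funext h
  rw [this]
  refine LowerSemicontinuous.measurable (lowerSemicontinuous_biSup fun q _ => ?_)
  exact (continuous_coe_real_ereal.comp (continuous_const.sub (hc q.1))).lowerSemicontinuous

/-- For a cost that is quadratic in its first variable, with Hessian `K`, the `c`-convex functions
are the convex ones up to the addition of the quadratic form of `K`. -/
theorem IsCConvex.convexOn (hψ : IsCConvex c ψ)
    (hc : ∀ x y, c x y = a y - inner ℝ (act M y) x + (1 / 2) * inner ℝ (act K x) x) :
    ConvexOn ℝ {x | ψ x ≠ ⊤} fun x => (ψ x).toReal + (1 / 2) * inner ℝ (act K x) x := by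
  have hbot := hψ.ne_bot
  obtain ⟨-, S, -, h⟩ := hψ
  have hle : ∀ x, ψ x ≠ ⊤ → ∀ q ∈ S, q.2 - c x q.1 ≤ (ψ x).toReal := fun x hx q hq => by
    rw [← EReal.coe_le_coe_iff, EReal.coe_toReal hx (hbot x), h]
    exact le_iSup₂ (f := fun (q : E n × ℝ) (_ : q ∈ S) => ((q.2 - c x q.1 : ℝ) : EReal)) q hq
  have key : ∀ x ∈ {x | ψ x ≠ ⊤}, ∀ y ∈ {x | ψ x ≠ ⊤}, ∀ s t : ℝ, 0 ≤ s → 0 ≤ t → s + t = 1 →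
      ψ (s • x + t • y) ≤ ((s * ((ψ x).toReal + (1 / 2) * inner ℝ (act K x) x)
        + t * ((ψ y).toReal + (1 / 2) * inner ℝ (act K y) y)
        - (1 / 2) * inner ℝ (act K (s • x + t • y)) (s • x + t • y) : ℝ) : EReal) := by
    intro x hx y hy s t hs ht hst
    rw [h]
    refine iSup₂_le fun q hq => EReal.coe_le_coe_iff.2 ?_
    have h1 := mul_le_mul_of_nonneg_left (hle x hx q hq) hs
    have h2 := mul_le_mul_of_nonneg_left (hle y hy q hq) ht
    rw [hc] at h1 h2
    rw [hc, inner_add_right (act M q.1), inner_smul_right, inner_smul_right]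
    have h3 : q.2 - a q.1 = s * (q.2 - a q.1) + t * (q.2 - a q.1) := by
      rw [← add_mul, hst, one_mul]
    linarith
  refine ⟨fun x hx y hy s t hs ht hst =>
    ((key x hx y hy s t hs ht hst).trans_lt (EReal.coe_lt_top _)).ne,
    fun x hx y hy s t hs ht hst => ?_⟩
  have h1 := key x hx y hy s t hs ht hst
  have h2 := (h1.trans_lt (EReal.coe_lt_top _)).ne
  rw [← EReal.coe_toReal h2 (hbot _), EReal.coe_le_coe_iff] at h1
  simp only [smul_eq_mul]
  linarith

theorem hasGradientAt_quadratic (hK : K.IsSymm) (x : E n) :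
    HasGradientAt (fun x => (1 / 2) * inner ℝ (act K x) x) (act K x) x := by
  rw [hasGradientAt_iff_hasFDerivAt]
  have h := (((actCLM K).hasFDerivAt (x := x)).inner ℝ (hasFDerivAt_id x)).const_mul (1 / 2)
  refine h.congr_fderiv ?_
  ext v
  have := inner_act_self_comm hK v x
  simp only [_root_.smul_apply, ContinuousLinearMap.comp_apply,
    ContinuousLinearMap.prod_apply, fderivInnerCLM_apply, actCLM_apply, smul_eq_mul,
    InnerProductSpace.toDual_apply_apply, id, ContinuousLinearMap.id_apply, this]
  ring

theorem mem_interior_of_finiteNear {x : E n} (h : FiniteNear ψ x) :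
    x ∈ interior {x | ψ x ≠ ⊤} :=
  mem_interior_iff_mem_nhds.2 (h.mono fun _ hz => hz.1)

theorem IsCConvex.finiteNear (hψ : IsCConvex c ψ) {x : E n}
    (hx : x ∈ interior {x | ψ x ≠ ⊤}) : FiniteNear ψ x :=
  Filter.mem_of_superset (mem_interior_iff_mem_nhds.1 hx) fun z hz => ⟨hz, hψ.ne_bot z⟩

theorem hasGradientAt_add_quadratic (hK : K.IsSymm) {z : E n} (hz : z ∈ diffSet ψ) :
    HasGradientAt (fun x => (ψ x).toReal + (1 / 2) * inner ℝ (act K x) x)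
      (gradient (fun w => (ψ w).toReal) z + act K z) z := by
  have h1 := hasGradientAt_iff_hasFDerivAt.1 hz.2.hasGradientAt
  have h2 := hasGradientAt_iff_hasFDerivAt.1 (hasGradientAt_quadratic hK z)
  rw [hasGradientAt_iff_hasFDerivAt, map_add]
  exact h1.fun_add h2

/-- The gradient of the potential, shifted by that of the quadratic form of `K`, is a subgradient of
the convex function associated with the potential. -/
theorem IsCConvex.subgradient (hψ : IsCConvex c ψ) (hK : K.IsSymm)
    (hc : ∀ x y, c x y = a y - inner ℝ (act M y) x + (1 / 2) * inner ℝ (act K x) x)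
    {z w : E n} (hz : z ∈ diffSet ψ) (hw : ψ w ≠ ⊤) :
    (ψ z).toReal + (1 / 2) * inner ℝ (act K z) z
        + inner ℝ (gradient (fun w => (ψ w).toReal) z + act K z) (w - z)
      ≤ (ψ w).toReal + (1 / 2) * inner ℝ (act K w) w := by
  have := (hψ.convexOn hc).add_fderiv_le hz.1.self_of_nhds.1 hw
    (hasGradientAt_iff_hasFDerivAt.1 (hasGradientAt_add_quadratic hK hz))
  simpa only [InnerProductSpace.toDual_apply_apply] using this

theorem IsCConvex.ae_mem_diffSet (hψ : IsCConvex c ψ) (hK : K.IsSymm)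
    (hc : ∀ x y, c x y = a y - inner ℝ (act M y) x + (1 / 2) * inner ℝ (act K x) x) :
    ∀ᵐ z, z ∈ interior {x | ψ x ≠ ⊤} → z ∈ diffSet ψ := by
  filter_upwards [(hψ.convexOn hc).ae_differentiableAt] with z hz hzi
  refine ⟨hψ.finiteNear hzi, ?_⟩
  have h := (hz hzi).fun_sub
    (hasGradientAt_iff_hasFDerivAt.1 (hasGradientAt_quadratic hK z)).differentiableAt
  simpa only [add_sub_cancel_right] using h

theorem IsCConvex.ae_mem_diffSet_of_ne_top (hψ : IsCConvex c ψ) (hK : K.IsSymm)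
    (hc : ∀ x y, c x y = a y - inner ℝ (act M y) x + (1 / 2) * inner ℝ (act K x) x)
    {μ : Measure (E n)} (hμ : μ.AbsolutelyContinuous volume) (htop : ∀ᵐ z ∂μ, ψ z ≠ ⊤) :
    ∀ᵐ z ∂μ, z ∈ diffSet ψ := by
  have hfr : ∀ᵐ z ∂μ, z ∉ frontier {x | ψ x ≠ ⊤} :=
    hμ.ae_le (measure_eq_zero_iff_ae_notMem.1 ((hψ.convexOn hc).1.addHaar_frontier volume))
  filter_upwards [htop, hfr, hμ.ae_le (hψ.ae_mem_diffSet hK hc)] with z h1 h2 h3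
  refine h3 ?_
  by_contra h4
  exact h2 ⟨subset_closure h1, h4⟩

/-- The points of differentiability are dense in the interior of the domain, hence determine
derivatives there. -/
theorem IsCConvex.uniqueDiffWithinAt_diffSet (hψ : IsCConvex c ψ) (hK : K.IsSymm)
    (hc : ∀ x y, c x y = a y - inner ℝ (act M y) x + (1 / 2) * inner ℝ (act K x) x)
    {x : E n} (hx : FiniteNear ψ x) : UniqueDiffWithinAt ℝ (diffSet ψ) x := by
  have hsub : interior {x | ψ x ≠ ⊤} ⊆ closure (diffSet ψ) := by
    intro z hz
    by_contra hcl
    set U := interior {x | ψ x ≠ ⊤} ∩ (closure (diffSet ψ))ᶜ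
    have hU : IsOpen U := isOpen_interior.inter isClosed_closure.isOpen_compl
    have h0 : volume U = 0 := by
      refine measure_eq_zero_iff_ae_notMem.2 ?_
      filter_upwards [hψ.ae_mem_diffSet hK hc] with w hw hwU
      exact hwU.2 (subset_closure (hw hwU.1))
    exact (hU.measure_pos volume ⟨z, hz, hcl⟩).ne' h0
  rw [← uniqueDiffWithinAt_closure]
  exact uniqueDiffWithinAt_of_mem_nhds
    (mem_of_superset (isOpen_interior.mem_nhds (mem_interior_of_finiteNear hx)) hsub)

/-- At a point of second order expansion of the potential, its gradient is differentiable along the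
points where it exists, and the Hessian is bounded below by that of `-c`. -/
theorem IsCConvex.hasFDerivWithinAt_gradient (hψ : IsCConvex c ψ) (hK : K.IsSymm)
    (hc : ∀ x y, c x y = a y - inner ℝ (act M y) x + (1 / 2) * inner ℝ (act K x) x)
    {x : E n} (hx : TwiceDifferentiableAt ψ x) :
    x ∈ diffSet ψ ∧ ∃ G : Matrix (Fin n) (Fin n) ℝ, (G + K).PosSemidef ∧
      HasFDerivWithinAt (gradient fun w => (ψ w).toReal) (actCLM G) (diffSet ψ) x := by
  obtain ⟨hfin, p, G, hG, hexp⟩ := hx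
  have hgrad : HasGradientAt (fun w => (ψ w).toReal) p x := hasGradientAt_of_expansion hexp
  have hxD : x ∈ diffSet ψ := ⟨hfin, hgrad.differentiableAt⟩
  have hp : gradient (fun w => (ψ w).toReal) x = p := hgrad.gradient
  have hs : {x | ψ x ≠ ⊤} ∈ 𝓝 x := hfin.mono fun z hz => hz.1
  have hGK : (G + K).IsSymm := hG.add hK
  have hexp' : (fun h : E n => ((ψ (x + h)).toReal + (1 / 2) * inner ℝ (act K (x + h)) (x + h))
      - ((ψ x).toReal + (1 / 2) * inner ℝ (act K x) x) - inner ℝ (p + act K x) h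
      - (1 / 2) * inner ℝ (act (G + K) h) h) =o[𝓝 0] fun h : E n => ‖h‖ ^ 2 := by
    refine hexp.congr_left fun h => ?_
    rw [act_add, add_act, inner_add_left, inner_add_left, inner_add_left, inner_add_right,
      inner_add_right, inner_act_self_comm hK h x]
    ring
  refine ⟨hxD, G, ?_, ?_⟩
  · refine posSemidef_of_expansion (φ := fun x => (ψ x).toReal + (1 / 2) * inner ℝ (act K x) x)
      (p := p + act K x) hGK ?_ hexp'
    have : Tendsto (fun h : E n => x + h) (𝓝 0) (𝓝 x) := by
      simpa using (continuous_const_add x).tendsto (0 : E n)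
    filter_upwards [this.eventually hs] with h hh
    have := hψ.subgradient hK hc hxD hh
    rwa [hp, add_sub_cancel_left] at this
  · rw [hasFDerivWithinAt_iff_isLittleO, isLittleO_iff]
    intro ε hε
    have hev := norm_subgradient_sub_le
      (φ := fun x => (ψ x).toReal + (1 / 2) * inner ℝ (act K x) x) hGK hs hexp' hε
    have ht : Tendsto (fun z : E n => z - x) (𝓝[diffSet ψ] x) (𝓝 0) := by
      have : Tendsto (fun z : E n => z - x) (𝓝 x) (𝓝 0) := by
        simpa using (continuous_sub_right x).tendsto x
      exact this.mono_left nhdsWithin_le_nhds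
    filter_upwards [ht.eventually hev, self_mem_nhdsWithin] with z hz hzD
    rcases eq_or_ne z x with rfl | hzx
    · simp
    have h := hz (sub_ne_zero.2 hzx) (gradient (fun w => (ψ w).toReal) z + act K z) (fun y hy => by
      rw [add_sub_cancel]
      exact hψ.subgradient hK hc hzD hy)
    rw [hp, actCLM_apply]
    have e : gradient (fun w => (ψ w).toReal) z + act K z - (p + act K x) - act (G + K) (z - x)
        = gradient (fun w => (ψ w).toReal) z - p - act G (z - x) := by
      rw [add_act, act_sub K]; abel
    rwa [e] at h

end Potential

/-! ### Sufficient condition for optimality of a transport map -/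

section Optimal

/-- A map whose graph lies, up to a null set of base points, in the contact set of a potential is
optimal. The potential need not be integrable beforehand: the contact inequality at two points
bounds it by values of the cost. -/
theorem isOptimalPlan_of_contact {c : E n → E n → ℝ}
    (hcont : Continuous fun q : E n × E n => c q.1 q.2) {C : ℝ}
    (hC : ∀ x y, |c x y| ≤ C * (‖x‖ ^ 2 + ‖y‖ ^ 2)) {μ : Measure (E n)} [IsProbabilityMeasure μ]
    (hμ : MemLp id 2 μ) {F : E n → E n} (hF : Measurable F) (hF2 : MemLp F 2 μ) {f : E n → ℝ}
    (hf : Measurable f) {D : Set (E n)} (hD : ∀ᵐ z ∂μ, z ∈ D)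
    (h : ∀ z ∈ D, ∀ w ∈ D, f z + c z (F z) ≤ f w + c w (F z)) :
    IsOptimalPlan c μ (μ.map F) (μ.map fun z => (z, F z)) := by
  have hint : ∀ {Ω : Type} [MeasurableSpace Ω] {P : Measure Ω} {X Y : Ω → E n},
      MemLp X 2 P → MemLp Y 2 P → Integrable (fun ω => c (X ω) (Y ω)) P := by
    intro Ω _ P X Y hX hY
    refine (((hX.norm.integrable_sq).add (hY.norm.integrable_sq)).const_mul C).mono'
      (hcont.comp_aestronglyMeasurable
        (hX.aestronglyMeasurable.prodMk hY.aestronglyMeasurable)) (.of_forall fun ω => ?_)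
    exact hC _ _
  have hcF : Integrable (fun z => c z (F z)) μ := hint hμ hF2
  obtain ⟨z₀, hz₀⟩ := hD.exists
  have hfi : Integrable f μ := by
    have b1 : Integrable (fun z => c z₀ (F z)) μ := hint (memLp_const z₀) hF2
    have b2 : Integrable (fun z => c z (F z₀)) μ := hint hμ (memLp_const _)
    refine (((b1.norm.add hcF.norm).add b2.norm).add
      (integrable_const (|f z₀| + |c z₀ (F z₀)|))).mono' hf.aestronglyMeasurable ?_
    filter_upwards [hD] with z hz
    have i1 := h z hz z₀ hz₀
    have i2 := h z₀ hz₀ z hz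
    simp only [Pi.add_apply, Real.norm_eq_abs]
    have j1 := abs_le.1 (le_refl |f z₀|)
    have j2 := abs_le.1 (le_refl |c z₀ (F z₀)|)
    have j3 := abs_le.1 (le_refl |c z₀ (F z)|)
    have j4 := abs_le.1 (le_refl |c z (F z)|)
    have j5 := abs_le.1 (le_refl |c z (F z₀)|)
    rw [abs_le]
    constructor <;> linarith [abs_nonneg (f z₀), abs_nonneg (c z₀ (F z₀)),
      abs_nonneg (c z₀ (F z)), abs_nonneg (c z (F z)), abs_nonneg (c z (F z₀))]
  -- The `c`-transform of `f` on `D`: together with `f` it is a competitor in the dual problem, and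
  -- being an infimum of continuous functions it is measurable even if `D` is not.
  set g : E n → EReal := fun y => ⨅ w ∈ D, ((f w + c w y : ℝ) : EReal) with hg
  have hgm : Measurable g := by
    refine UpperSemicontinuous.measurable (upperSemicontinuous_biInf fun w _ => ?_)
    have hcw : Continuous fun y => c w y := hcont.comp (Continuous.prodMk_right w)
    exact (continuous_coe_real_ereal.comp (continuous_const.add hcw)).upperSemicontinuous
  have hgF : ∀ z ∈ D, g (F z) = ((f z + c z (F z) : ℝ) : EReal) := fun z hz =>
    le_antisymm (iInf₂_le (f := fun w (_ : w ∈ D) => ((f w + c w (F z) : ℝ) : EReal)) z hz)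
      (le_iInf₂ fun w hw => EReal.coe_le_coe_iff.2 (h z hz w hw))
  have hGm : Measurable fun y => (g y).toReal := hgm.ereal_toReal
  have hGF : (fun z => (g (F z)).toReal) =ᵐ[μ] fun z => f z + c z (F z) := by
    filter_upwards [hD] with z hz
    rw [hgF z hz, EReal.toReal_coe]
  have hGi : Integrable (fun y => (g y).toReal) (μ.map F) :=
    (integrable_map_measure hGm.aestronglyMeasurable hF.aemeasurable).2
      ((hfi.add hcF).congr hGF.symm)
  refine ⟨?_, ?_, fun β hβ1 hβ2 => ?_⟩
  · rw [Measure.fst_map_prodMk hF, Measure.map_id']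
  · rw [Measure.snd_map_prodMk measurable_id']
  have hm1 : AEMeasurable (Prod.fst : E n × E n → E n) β := measurable_fst.aemeasurable
  have hm2 : AEMeasurable (Prod.snd : E n × E n → E n) β := measurable_snd.aemeasurable
  rw [Measure.fst] at hβ1
  rw [Measure.snd] at hβ2
  have hL1 : MemLp (Prod.fst : E n × E n → E n) 2 β := by
    rw [← hβ1] at hμ
    exact hμ.comp_of_map hm1
  have hL2 : MemLp (Prod.snd : E n × E n → E n) 2 β := by
    have : MemLp id 2 (μ.map F) :=
      (memLp_map_measure_iff aestronglyMeasurable_id hF.aemeasurable).2 hF2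
    rw [← hβ2] at this
    exact this.comp_of_map hm2
  have hcβ : Integrable (fun q : E n × E n => c q.1 q.2) β := hint hL1 hL2
  have hfβ : Integrable (fun q : E n × E n => f q.1) β := by
    rw [← hβ1] at hfi
    exact hfi.comp_aemeasurable hm1
  have hGβ : Integrable (fun q : E n × E n => (g q.2).toReal) β := by
    rw [← hβ2] at hGi
    exact hGi.comp_aemeasurable hm2
  have hD1 : ∀ᵐ q ∂β, q.1 ∈ D := by
    rw [← hβ1] at hD
    exact ae_of_ae_map hm1 hD
  have hD2 : ∀ᵐ q ∂β, g q.2 ≠ ⊥ := by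
    have : ∀ᵐ y ∂(μ.map F), g y ≠ ⊥ := by
      refine (ae_map_iff hF.aemeasurable (hgm (measurableSet_singleton ⊥).compl)).2 ?_
      filter_upwards [hD] with z hz
      change g (F z) ≠ ⊥
      rw [hgF z hz]
      exact EReal.coe_ne_bot _
    rw [← hβ2] at this
    exact ae_of_ae_map hm2 this
  have hle : ∫ q, (g q.2).toReal ∂β ≤ ∫ q, (f q.1 + c q.1 q.2) ∂β := by
    refine integral_mono_ae hGβ (hfβ.add hcβ) ?_
    filter_upwards [hD1, hD2] with q h1 h2
    have h3 : g q.2 ≤ ((f q.1 + c q.1 q.2 : ℝ) : EReal) :=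
      iInf₂_le (f := fun w (_ : w ∈ D) => ((f w + c w q.2 : ℝ) : EReal)) q.1 h1
    have := EReal.toReal_le_toReal h3 h2 (EReal.coe_ne_top _)
    rwa [EReal.toReal_coe] at this
  rw [integral_add hfβ hcβ] at hle
  have e1 : ∫ q, f q.1 ∂β = ∫ z, f z ∂μ := by
    conv_rhs => rw [← hβ1]
    exact (integral_map hm1 hf.aestronglyMeasurable).symm
  have e2 : ∫ q, (g q.2).toReal ∂β = ∫ z, f z ∂μ + ∫ z, c z (F z) ∂μ := by
    rw [← integral_add hfi hcF, ← integral_congr_ae hGF,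
      ← integral_map hF.aemeasurable hGm.aestronglyMeasurable, ← hβ2]
    exact (integral_map hm2 hGm.aestronglyMeasurable).symm
  rw [integral_map (measurable_id'.prodMk hF).aemeasurable hcont.aestronglyMeasurable]
  rw [e1, e2] at hle
  exact le_of_add_le_add_left hle

end Optimal

/-! ### The transport maps -/

section Transport

open scoped Matrix

variable {A : Matrix (Fin n) (Fin n) ℝ} {B : Matrix (Fin n) (Fin m) ℝ}
  {Q : Matrix (Fin n) (Fin n) ℝ} {r T : ℝ}

/-- Before the first conjugate time there is a whole interval `(0, r]`, with `r > T`, without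
conjugate times. -/
theorem exists_gt_isUnit_det_R₃ (hT' : (T : EReal) < firstConjugateTime A B Q) :
    ∃ r > T, ∀ t ∈ Ioc 0 r, IsUnit (R₃ A B Q t).det := by
  obtain ⟨r, h1, h2⟩ := EReal.lt_iff_exists_real_btwn.1 hT'
  exact ⟨r, EReal.coe_lt_coe_iff.1 h1, fun t ht =>
    isUnit_det_R₃ A B Q ht.1 ((EReal.coe_le_coe_iff.2 ht.2).trans_lt h2)⟩

theorem continuous_cost (hQ : Q.IsSymm) (hr : ∀ t ∈ Ioc 0 r, IsUnit (R₃ A B Q t).det)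
    (hT : 0 < T) (hTr : T < r) : Continuous fun q : E n × E n => cost A B Q T q.1 q.2 := by
  simp only [cost_eq hQ hr hT hTr]
  have h1 : Continuous fun q : E n × E n => act (finalHess A B Q T) q.2 :=
    (continuous_act _).comp continuous_snd
  have h2 : Continuous fun q : E n × E n => act (R₃ A B Q T)⁻¹ q.2 :=
    (continuous_act _).comp continuous_snd
  have h3 : Continuous fun q : E n × E n => act (initialHess A B Q T) q.1 :=
    (continuous_act _).comp continuous_fst
  exact ((continuous_const.mul (h1.inner continuous_snd)).sub (h2.inner continuous_fst)).add
    (continuous_const.mul (h3.inner continuous_fst))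

theorem abs_cost_le (hQ : Q.IsSymm) (hr : ∀ t ∈ Ioc 0 r, IsUnit (R₃ A B Q t).det)
    (hT : 0 < T) (hTr : T < r) : ∃ C, ∀ x y : E n, |cost A B Q T x y| ≤ C * (‖x‖ ^ 2 + ‖y‖ ^ 2) := by
  have b : ∀ (N : Matrix (Fin n) (Fin n) ℝ) (x y : E n),
      |inner ℝ (act N y) x| ≤ ‖actCLM N‖ * (‖x‖ ^ 2 + ‖y‖ ^ 2) := fun N x y => by
    calc |inner ℝ (act N y) x| ≤ ‖act N y‖ * ‖x‖ := abs_real_inner_le_norm _ _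
      _ ≤ ‖actCLM N‖ * ‖y‖ * ‖x‖ := by gcongr; exact (actCLM N).le_opNorm y
      _ = ‖actCLM N‖ * (‖y‖ * ‖x‖) := by ring
      _ ≤ _ := by gcongr; nlinarith [sq_nonneg (‖x‖ - ‖y‖), sq_nonneg ‖x‖, sq_nonneg ‖y‖]
  refine ⟨‖actCLM (finalHess A B Q T)‖ + ‖actCLM (R₃ A B Q T)⁻¹‖
    + ‖actCLM (initialHess A B Q T)‖, fun x y => ?_⟩
  rw [cost_eq hQ hr hT hTr]
  have h1 := abs_le.1 (b (finalHess A B Q T) y y)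
  have h2 := abs_le.1 (b (R₃ A B Q T)⁻¹ x y)
  have h3 := abs_le.1 (b (initialHess A B Q T) x x)
  have i1 : 0 ≤ ‖actCLM (finalHess A B Q T)‖ * ‖x‖ ^ 2 := by positivity
  have i3 : 0 ≤ ‖actCLM (initialHess A B Q T)‖ * ‖y‖ ^ 2 := by positivity
  rw [abs_le]
  constructor <;> linarith

theorem transportMap_zero (ψ : E n → EReal) (z : E n) : transportMap A B Q ψ 0 z = z :=
  expMap_zero A B Q z _

theorem inv_R₃_act_transportMap {τ : ℝ} (hτ : IsUnit (R₃ A B Q τ).det) (ψ : E n → EReal)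
    (z : E n) : act (R₃ A B Q τ)⁻¹ (transportMap A B Q ψ τ z)
      = gradient (fun w => (ψ w).toReal) z + act (initialHess A B Q τ) z := by
  rw [transportMap, expMap, act_add, ← act_mul, ← act_mul, Matrix.nonsing_inv_mul _ hτ, act_one,
    initialHess]

theorem measurable_transportMap (ψ : E n → EReal) (τ : ℝ) :
    Measurable (transportMap A B Q ψ τ) := by
  have h : Measurable (gradient fun w : E n => (ψ w).toReal) :=
    (InnerProductSpace.toDual ℝ (E n)).symm.continuous.measurable.comp (measurable_fderiv ℝ _)
  exact ((continuous_act _).measurable.comp h).add (continuous_act _).measurable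

/-- Every `T_τ` is an affine image of the pair of `T_T` and of the identity, hence has a finite
second moment if these have. -/
theorem memLp_transportMap (hu : IsUnit (R₃ A B Q T).det) {ψ : E n → EReal} {μ : Measure (E n)}
    (hμ : MemLp id 2 μ) (hT : MemLp (transportMap A B Q ψ T) 2 μ) (τ : ℝ) :
    MemLp (transportMap A B Q ψ τ) 2 μ := by
  have hclm : ∀ (N : Matrix (Fin n) (Fin n) ℝ) {f : E n → E n}, MemLp f 2 μ →
      MemLp (fun z => act N (f z)) 2 μ := fun N f hf => (actCLM N).comp_memLp' hf
  have hg : MemLp (gradient fun w => (ψ w).toReal) 2 μ := by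
    refine ((hclm (R₃ A B Q T)⁻¹ hT).sub (hclm (initialHess A B Q T) hμ)).ae_eq
      (.of_forall fun z => ?_)
    simp only [Pi.sub_apply, id]
    rw [inv_R₃_act_transportMap hu, add_sub_cancel_right]
  exact (hclm _ hg).add (hclm _ hμ)

/-- The graph of `T_τ` lies in the contact set of the potential for the cost `c^{0,τ}`, among the
points of differentiability: the potential stays convex relative to `c^{0,τ}` because the Hessian
of the cost in its first variable decreases with the time. -/
theorem contact_transportMap (hQ : Q.IsSymm) (hr : ∀ t ∈ Ioc 0 r, IsUnit (R₃ A B Q t).det)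
    (hT : 0 < T) (hTr : T < r) {ψ : E n → EReal} (hψ : IsCConvex (cost A B Q T) ψ) {τ : ℝ}
    (hτ : τ ∈ Ioc 0 T) {z w : E n} (hz : z ∈ diffSet ψ) (hw : ψ w ≠ ⊤) :
    (ψ z).toReal + cost A B Q τ z (transportMap A B Q ψ τ z)
      ≤ (ψ w).toReal + cost A B Q τ w (transportMap A B Q ψ τ z) := by
  have hu := hr T ⟨hT, hTr.le⟩
  have huτ := hr τ ⟨hτ.1, hτ.2.trans hTr.le⟩
  have hK := isSymm_initialHess (A := A) (B := B) hQ hu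
  have hKτ := isSymm_initialHess (A := A) (B := B) hQ huτ
  have h := hψ.subgradient hK (cost_eq hQ hr hT hTr) hz hw
  have hP := (posSemidef_initialHess_sub hQ hr hτ.1 hτ.2 hTr.le).inner_nonneg (w - z)
  rw [cost_eq hQ hr hτ.1 (hτ.2.trans_lt hTr), cost_eq hQ hr hτ.1 (hτ.2.trans_lt hTr),
    inv_R₃_act_transportMap huτ]
  simp only [sub_act, act_sub, inner_add_left, inner_sub_left, inner_sub_right] at h hP ⊢
  have s1 := inner_act_self_comm hK z w
  have s2 := inner_act_self_comm hKτ z w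
  linarith

/-- At a point of differentiability of the potential, the only point in contact is the image under
`T_T`: this is the first order condition. -/
theorem eq_transportMap_of_mem_contactSet (hQ : Q.IsSymm)
    (hr : ∀ t ∈ Ioc 0 r, IsUnit (R₃ A B Q t).det) (hT : 0 < T) (hTr : T < r) {ψ : E n → EReal}
    {z y : E n} (hz : z ∈ diffSet ψ)
    (h : (z, y) ∈ contactSet (cost A B Q T) ψ) : y = transportMap A B Q ψ T z := by
  have hu := hr T ⟨hT, hTr.le⟩
  have hK := isSymm_initialHess (A := A) (B := B) hQ hu
  have hg := hasGradientAt_add_quadratic hK hz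
  rw [hasGradientAt_iff_hasFDerivAt] at hg
  have hlin := hg.fun_sub ((innerSL ℝ (act (R₃ A B Q T)⁻¹ y)).hasFDerivAt (x := z))
  have hmin : IsLocalMin (fun w => (ψ w).toReal
      + (1 / 2) * inner ℝ (act (initialHess A B Q T) w) w
      - innerSL ℝ (act (R₃ A B Q T)⁻¹ y) w) z := by
    have hzf := hz.1.self_of_nhds
    filter_upwards [hz.1] with w hw
    have h1 : cost A B Q T z y + ψ z ≤ ψ w + cost A B Q T w y := by
      have h' : cTransform (cost A B Q T) ψ y = cost A B Q T z y + ψ z := h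
      rw [← h']
      exact iInf_le _ w
    rw [← EReal.coe_toReal hw.1 hw.2, ← EReal.coe_toReal hzf.1 hzf.2, ← EReal.coe_add,
      ← EReal.coe_add, EReal.coe_le_coe_iff, cost_eq hQ hr hT hTr, cost_eq hQ hr hT hTr] at h1
    simp only [innerSL_apply_apply]
    linarith
  have h0 := hmin.hasFDerivAt_eq_zero hlin
  have h1 : gradient (fun w => (ψ w).toReal) z + act (initialHess A B Q T) z
      = act (R₃ A B Q T)⁻¹ y := by
    refine ext_inner_right ℝ fun v => ?_
    have := congrArg (fun L : E n →L[ℝ] ℝ => L v) (sub_eq_zero.1 h0)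
    simpa only [InnerProductSpace.toDual_apply_apply, innerSL_apply_apply] using this
  rw [← inv_R₃_act_transportMap hu] at h1
  have := congrArg (act (R₃ A B Q T)) h1
  rw [← act_mul, ← act_mul, Matrix.mul_nonsing_inv _ hu, act_one, act_one] at this
  exact this.symm

variable {μ ν : Measure (E n)} {ψ : E n → EReal}

/-- A potential is finite almost everywhere: where it is `+∞`, contact would force its transform to
be `+∞` as well. -/
theorem IsKantorovichPotential.ae_ne_top {c : E n → E n → ℝ} (h : IsKantorovichPotential c μ ν ψ)
    (hc : ∀ y, Continuous fun x => c x y) : ∀ᵐ z ∂μ, ψ z ≠ ⊤ := by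
  obtain ⟨hψ, α, ⟨hα1, -, -⟩, hα⟩ := h
  have hm := hψ.measurable hc
  obtain ⟨x₀, hx₀⟩ := hψ.1
  rw [← hα1, Measure.fst]
  refine (ae_map_iff measurable_fst.aemeasurable (hm (measurableSet_singleton ⊤).compl)).2 ?_
  filter_upwards [hα] with q hq htop
  have htop : ψ q.1 = ⊤ := htop
  have h1 : cTransform c ψ q.2 = c q.1 q.2 + ψ q.1 := hq
  have h2 : cTransform c ψ q.2 ≤ ψ x₀ + c x₀ q.2 := iInf_le _ x₀
  rw [h1, htop, EReal.coe_add_top, ← EReal.coe_toReal hx₀ (hψ.ne_bot x₀), ← EReal.coe_add] at h2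
  exact (EReal.coe_lt_top _).not_ge h2

/-- An optimal plan concentrated on the contact set is carried by the graph of `T_T`. -/
theorem map_transportMap_eq (hQ : Q.IsSymm) (hr : ∀ t ∈ Ioc 0 r, IsUnit (R₃ A B Q t).det)
    (hT : 0 < T) (hTr : T < r) (hψ : IsKantorovichPotential (cost A B Q T) μ ν ψ)
    (hD : ∀ᵐ z ∂μ, z ∈ diffSet ψ) : μ.map (transportMap A B Q ψ T) = ν := by
  obtain ⟨-, α, ⟨hα1, hα2, -⟩, hα⟩ := hψ
  have hD' : ∀ᵐ q ∂α, q.1 ∈ diffSet ψ := by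
    rw [← hα1, Measure.fst] at hD
    exact ae_of_ae_map measurable_fst.aemeasurable hD
  have heq : Prod.snd =ᵐ[α] fun q => transportMap A B Q ψ T q.1 := by
    filter_upwards [hα, hD'] with q h1 h2
    exact eq_transportMap_of_mem_contactSet hQ hr hT hTr h2 h1
  rw [← hα2, Measure.snd, Measure.map_congr heq, ← hα1, Measure.fst,
    Measure.map_map (measurable_transportMap ψ T) measurable_fst]
  rfl

theorem hasFDerivWithinAt_transportMap {x : E n} {G : Matrix (Fin n) (Fin n) ℝ}
    (hG : HasFDerivWithinAt (gradient fun w => (ψ w).toReal) (actCLM G) (diffSet ψ) x) (τ : ℝ) :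
    HasFDerivWithinAt (transportMap A B Q ψ τ) (actCLM (R₃ A B Q τ * G + R₄ A B Q τ))
      (diffSet ψ) x := by
  have h := ((actCLM (R₃ A B Q τ)).hasFDerivAt.comp_hasFDerivWithinAt x hG).add
    (actCLM (R₄ A B Q τ)).hasFDerivWithinAt
  refine h.congr_fderiv ?_
  ext1 v
  simp [act_mul]

end Transport

end LQ

theorem theorem5p2 {n m : ℕ} (hn : 1 ≤ n)
    (A : Matrix (Fin n) (Fin n) ℝ) (B : Matrix (Fin n) (Fin m) ℝ) (Q : Matrix (Fin n) (Fin n) ℝ)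
    (hQ : Q.IsSymm) (hAB : Kalman A B)
    (T : ℝ) (hT : 0 < T) (hT' : (T : EReal) < firstConjugateTime A B Q)
    (μ ν : MeasureTheory.Measure (E n))
    [MeasureTheory.IsProbabilityMeasure μ] [MeasureTheory.IsProbabilityMeasure ν]
    (hμ₂ : MeasureTheory.MemLp id 2 μ) (hν₂ : MeasureTheory.MemLp id 2 ν)
    (hμ : μ.AbsolutelyContinuous MeasureTheory.volume)
    (ψ : E n → EReal) (hψ : IsKantorovichPotential (cost A B Q T) μ ν ψ) :
    -- the maps `T_τ` are the optimal transport maps along the displacement interpolation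
    ((∀ᵐ z ∂μ, z ∈ diffSet ψ ∧ transportMap A B Q ψ 0 z = z ∧
        IsOptimalTrajectory A B Q T fun τ => transportMap A B Q ψ τ z) ∧
      IsOptimalMap (cost A B Q T) μ ν (transportMap A B Q ψ T) ∧
      ∀ τ ∈ Set.Ioc 0 T, IsOptimalMap (cost A B Q τ) μ (μ.map (transportMap A B Q ψ τ))
        (transportMap A B Q ψ τ)) ∧
    ∀ x : E n, TwiceDifferentiableAt ψ x →
      -- differentiability of every `T_τ` at `x`
      (x ∈ diffSet ψ ∧ UniqueDiffWithinAt ℝ (diffSet ψ) x ∧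
        ∀ τ ∈ Set.Icc 0 T,
          DifferentiableWithinAt ℝ (transportMap A B Q ψ τ) (diffSet ψ) x) ∧
      -- the Jacobian estimate, and the signs of the two terms
      (∀ s ∈ Set.Ioc 0 T, ∀ τ ∈ Set.Icc 0 s,
        nthRoot n (R₃ A B Q (τ - s)).det / nthRoot n (R₃ A B Q (-s)).det
            + nthRoot n (R₃ A B Q τ).det / nthRoot n (R₃ A B Q s).det
              * nthRoot n (transportJacobian A B Q ψ s x).det
          ≤ nthRoot n (transportJacobian A B Q ψ τ x).det ∧
        0 ≤ nthRoot n (R₃ A B Q (τ - s)).det / nthRoot n (R₃ A B Q (-s)).det ∧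
        0 ≤ nthRoot n (R₃ A B Q τ).det / nthRoot n (R₃ A B Q s).det
              * nthRoot n (transportJacobian A B Q ψ s x).det ∧
        (τ < s →
          0 < nthRoot n (R₃ A B Q (τ - s)).det / nthRoot n (R₃ A B Q (-s)).det)) ∧
      (∀ τ ∈ Set.Ico 0 T, 0 < (transportJacobian A B Q ψ τ x).det) := by
  obtain ⟨r, hTr, hr⟩ := exists_gt_isUnit_det_R₃ hT'
  have hu := hr T ⟨hT, hTr.le⟩
  have hK := isSymm_initialHess (A := A) (B := B) hQ hu
  have hc := cost_eq (A := A) (B := B) hQ hr hT hTr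
  have hcont := continuous_cost (A := A) (B := B) hQ hr hT hTr
  have hD : ∀ᵐ z ∂μ, z ∈ diffSet ψ :=
    hψ.1.ae_mem_diffSet_of_ne_top hK hc hμ
      (hψ.ae_ne_top fun y => hcont.comp (Continuous.prodMk_left y))
  have hmap := map_transportMap_eq hQ hr hT hTr hψ hD
  have hmeas := measurable_transportMap (A := A) (B := B) (Q := Q) ψ
  have hmem : ∀ τ, MeasureTheory.MemLp (transportMap A B Q ψ τ) 2 μ := by
    refine memLp_transportMap hu hμ₂ ?_
    rw [← hmap] at hν₂
    exact hν₂.comp_of_map (hmeas T).aemeasurable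
  have hopt : ∀ τ ∈ Set.Ioc 0 T, IsOptimalMap (cost A B Q τ) μ
      (μ.map (transportMap A B Q ψ τ)) (transportMap A B Q ψ τ) := fun τ hτ => by
    obtain ⟨C, hC⟩ := abs_cost_le (A := A) (B := B) hQ hr hτ.1 (hτ.2.trans_lt hTr)
    exact ⟨(hmeas τ).aemeasurable, rfl,
      isOptimalPlan_of_contact (continuous_cost hQ hr hτ.1 (hτ.2.trans_lt hTr)) hC hμ₂ (hmeas τ)
        (hmem τ) (hψ.1.measurable fun y => hcont.comp (Continuous.prodMk_left y)).ereal_toReal hD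
        fun z hz w hw => contact_transportMap hQ hr hT hTr hψ.1 hτ hz hw.1.self_of_nhds.1⟩
  refine ⟨⟨?_, hmap ▸ hopt T ⟨hT, le_rfl⟩, hopt⟩, fun x hx => ?_⟩
  · filter_upwards [hD] with z hz
    exact ⟨hz, transportMap_zero ψ z, isOptimalTrajectory_expMap hQ hr hT.le hTr z _⟩
  obtain ⟨hxD, G, hGK, hG⟩ := hψ.1.hasFDerivWithinAt_gradient hK hc hx
  have huniq := hψ.1.uniqueDiffWithinAt_diffSet hK hc hx.1
  have hder := fun τ => hasFDerivWithinAt_transportMap (A := A) (B := B) (Q := Q) hG τ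
  have hdet : ∀ τ, (transportJacobian A B Q ψ τ x).det
      = (R₃ A B Q τ * G + R₄ A B Q τ).det := fun τ => by
    rw [transportJacobian, (hder τ).fderivWithin huniq, det_actCLM]
  have hGs : ∀ s ∈ Set.Ioc 0 T, (G + initialHess A B Q s).PosSemidef := fun s hs => by
    have := hGK.add (posSemidef_initialHess_sub hQ hr hs.1 hs.2 hTr.le)
    rwa [add_assoc, add_sub_cancel] at this
  have hsigns : ∀ t ∈ Set.Ioc 0 T, 0 < (R₃ A B Q t).det := fun t ht =>
    det_R₃_pos hQ hr ⟨ht.1, ht.2.trans_lt hTr⟩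
  refine ⟨⟨hxD, huniq, fun τ _ => (hder τ).differentiableWithinAt⟩, fun s hs τ hτ => ?_,
    fun τ hτ => ?_⟩
  · have hsr : s ∈ Set.Ioc 0 r := ⟨hs.1, hs.2.trans hTr.le⟩
    have hfirst : nthRoot n (R₃ A B Q (τ - s)).det / nthRoot n (R₃ A B Q (-s)).det
        = nthRoot n ((R₃ A B Q (s - τ)).det / (R₃ A B Q s).det) := by
      rw [← nthRoot_div _ _ (isUnit_det_R₃_neg hQ (hr s hsr)).ne_zero, det_R₃_neg_div hQ]
    have hpos : τ < s → 0 < nthRoot n (R₃ A B Q (τ - s)).det / nthRoot n (R₃ A B Q (-s)).det :=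
      fun hτs => by
        rw [hfirst]
        exact nthRoot_pos (div_pos
          (hsigns _ ⟨sub_pos.2 hτs, by linarith [hτ.1, hs.2]⟩) (hsigns s hs))
    refine ⟨?_, ?_, ?_, hpos⟩
    · rw [hdet, hdet]
      exact nthRoot_det_le hn hQ hr hsr hτ (hGs s hs)
    · rcases hτ.2.eq_or_lt with rfl | hτs
      · have : Nonempty (Fin n) := ⟨⟨0, hn⟩⟩
        rw [hfirst, sub_self, R₃_zero, Matrix.det_zero, zero_div]
        exact nthRoot_nonneg le_rfl
      · exact (hpos hτs).le
    · have h1 : 0 ≤ (R₃ A B Q τ).det := by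
        rcases hτ.1.eq_or_lt with rfl | h0
        · have : Nonempty (Fin n) := ⟨⟨0, hn⟩⟩
          rw [R₃_zero, Matrix.det_zero]
        · exact (hsigns τ ⟨h0, hτ.2.trans hs.2⟩).le
      have h2 : 0 ≤ (R₃ A B Q s * G + R₄ A B Q s).det := by
        rw [← R₃_mul_initialHess (hr s hsr), ← Matrix.mul_add, Matrix.det_mul]
        exact mul_nonneg (hsigns s hs).le (hGs s hs).det_nonneg
      rw [hdet]
      exact mul_nonneg (div_nonneg (nthRoot_nonneg h1) (nthRoot_nonneg (hsigns s hs).le))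
        (nthRoot_nonneg h2)
  · rw [hdet]
    exact det_R₃_mul_add_R₄_pos hQ hr hTr.le hGK hτ
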